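/- Let $\Lambda^2\mathbb{R}^4$ carry the inner product $\langle x\wedge y,z\wedge t\rangle=\langle x,z\rangle\langle y,t\rangle-\langle x,t\rangle\langle y,z\rangle$ and the Lie bracket of $\mathfrak{so}(4,\mathbb{R})$, through $x\wedge y\mapsto(u\mapsto\langle x,u\rangle y-\langle y,u\rangle x)$. Let $S^2_B\Lambda^2\mathbb{R}^4$ be the space of algebraic curvature operators, that is, of symmetric endomorphisms $R$ of $\Lambda^2\mathbb{R}^4$ with $$\langle R(x\wedge y),z\wedge t\rangle+\langle R(z\wedge x),y\wedge t\rangle+\langle R(y\wedge z),x\wedge t\rangle=0\qquad(x,y,z,t\in\mathbb{R}^4).$$ The group $O(4)$ acts on it by $\langle (g.R)(x\wedge y),z\wedge t\rangle=\langle R(gx\wedge gy),gz\wedge gt\rangle$. An *oriented* (resp. *unoriented*) *curvature cone* is a closed convex cone $\mathcal{C}\subset S^2_B\Lambda^2\mathbb{R}^4$ that is invariant under $SO(4)$ (resp. $O(4)$) and has the identity operator $\mathrm{Id}$ in its interior. Let $Q(R)=R^2+R^\#$, where $R^\#$ is the symmetric operator with $\langle R^\#\eta,\eta\rangle=-\frac12\sum_i\langle[\eta,R([\eta,R(\omega_i)])],\omega_i\rangle$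 for any orthonormal basis $(\omega_i)$ of $\Lambda^2\mathbb{R}^4$. The cone $\mathcal{C}$ is *Ricci flow invariant* if $Q(R)$ lies in the tangent cone $T_R\mathcal{C}$ for every $R\in\partial\mathcal{C}$. Let $\mathcal{C}_{\mathrm{scal}}$ be the cone of those $R\in S^2_B\Lambda^2\mathbb{R}^4$ with nonnegative scalar curvature $2\operatorname{tr}R$. Let $NNIC$ be the cone of those $R\in S^2_B\Lambda^2\mathbb{R}^4$ whose complex linear extension satisfies $\langle R(v\wedge w),v\wedge w\rangle\ge 0$, for the Hermitian inner product on $\Lambda^2\mathbb{R}^4\otimes\mathbb{C}$, whenever $v,w\in\mathbb{C}^4$ span a complex plane that is isotropic for the complex bilinear extension of the Euclidean inner product. Let $NNIC_+$ (resp. $NNIC_-$) be the cone defined by the same inequality, required only for those $v\wedge w$ that are self-dual (resp. anti-self-dual). 1. If $\mathcal{C}\subsetneq\mathcal{C}_{\mathrm{scal}}$ is a Ricci flow invariant oriented curvature cone, then $\mathcal{C}\subseteq NNIC_+$ or $\mathcal{C}\subseteq NNIC_-$. 2. If $\mathcal{C}\subsetneq\mathcal{C}_{\mathrm{scal}}$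 is a Ricci flow invariant unoriented curvature cone, then $\mathcal{C}\subseteq NNIC$. 3. Consequently $NNIC_+$ and $NNIC_-$ are maximal, with respect to inclusion, among the Ricci flow invariant oriented curvature cones that are strictly contained in $\mathcal{C}_{\mathrm{scal}}$; in particular they are themselves such cones. -/

import Mathlib

namespace HalfPIC

open Matrix

/-- The matrix of `φ (x ∧ y) : u ↦ ⟨x, u⟩ y - ⟨y, u⟩ x`, where `φ : Λ² K⁴ ≃ so(4, K)`. -/
def wedgeMatrix {K : Type*} [CommRing K] (x y : Fin 4 → K) : Matrix (Fin 4) (Fin 4) K :=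
  vecMulVec y x - vecMulVec x y

/-- `Λ² ℝ⁴`, realised as the skew-symmetric matrices `so(4, ℝ)` through
`φ (x ∧ y) : u ↦ ⟨x, u⟩ y - ⟨y, u⟩ x`. It is a type synonym, because it carries the inner
product `-½ tr (A B)`. -/
def Bivector : Type := LieAlgebra.Orthogonal.so (Fin 4) ℝ

namespace Bivector

instance : AddCommGroup Bivector := inferInstanceAs (AddCommGroup (LieAlgebra.Orthogonal.so (Fin 4) ℝ))
instance : Module ℝ Bivector := inferInstanceAs (Module ℝ (LieAlgebra.Orthogonal.so (Fin 4) ℝ))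

/-- The underlying skew-symmetric matrix. -/
def mat (A : Bivector) : Matrix (Fin 4) (Fin 4) ℝ := Subtype.val A

/-- The bivector given by a skew-symmetric matrix. -/
def ofMat (M : Matrix (Fin 4) (Fin 4) ℝ) (h : Mᵀ = -M) : Bivector :=
  ⟨M, (LieAlgebra.Orthogonal.mem_so (Fin 4) ℝ M).2 h⟩

@[simp] theorem mat_ofMat (M : Matrix (Fin 4) (Fin 4) ℝ) (h : Mᵀ = -M) : (ofMat M h).mat = M := rfl
theorem mat_transpose (A : Bivector) : A.matᵀ = -A.mat :=
  (LieAlgebra.Orthogonal.mem_so (Fin 4) ℝ A.mat).1 A.2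
@[ext] theorem ext {A B : Bivector} (h : A.mat = B.mat) : A = B := Subtype.ext h
@[simp] theorem mat_add (A B : Bivector) : (A + B).mat = A.mat + B.mat := rfl
@[simp] theorem mat_smul (c : ℝ) (A : Bivector) : (c • A).mat = c • A.mat := rfl
@[simp] theorem mat_zero : (0 : Bivector).mat = 0 := rfl
@[simp] theorem mat_neg (A : Bivector) : (-A).mat = -A.mat := rfl
@[simp] theorem mat_sub (A B : Bivector) : (A - B).mat = A.mat - B.mat := rfl

theorem mat_apply_swap (A : Bivector) (i j : Fin 4) : A.mat j i = - A.mat i j := by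
  have := congrFun (congrFun A.mat_transpose i) j
  simpa using this
theorem mat_apply_self (A : Bivector) (i : Fin 4) : A.mat i i = 0 := by
  have := A.mat_apply_swap i i
  linarith

theorem trace_mul (A B : Bivector) : -(1 / 2 : ℝ) * (A.mat * B.mat).trace =
    A.mat 0 1 * B.mat 0 1 + A.mat 0 2 * B.mat 0 2 + A.mat 0 3 * B.mat 0 3 +
    A.mat 1 2 * B.mat 1 2 + A.mat 1 3 * B.mat 1 3 + A.mat 2 3 * B.mat 2 3 := by
  simp only [Matrix.trace, Matrix.diag, Matrix.mul_apply, Fin.sum_univ_four]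
  rw [A.mat_apply_swap 0 1, A.mat_apply_swap 0 2, A.mat_apply_swap 0 3, A.mat_apply_swap 1 2,
    A.mat_apply_swap 1 3, A.mat_apply_swap 2 3, B.mat_apply_swap 0 1, B.mat_apply_swap 0 2,
    B.mat_apply_swap 0 3, B.mat_apply_swap 1 2, B.mat_apply_swap 1 3, B.mat_apply_swap 2 3]
  simp only [mat_apply_self]
  ring

theorem ext_entries {A B : Bivector} (h01 : A.mat 0 1 = B.mat 0 1) (h02 : A.mat 0 2 = B.mat 0 2)
    (h03 : A.mat 0 3 = B.mat 0 3) (h12 : A.mat 1 2 = B.mat 1 2) (h13 : A.mat 1 3 = B.mat 1 3)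
    (h23 : A.mat 2 3 = B.mat 2 3) : A = B := by
  ext i j
  fin_cases i <;> fin_cases j <;>
    simp [mat_apply_self, A.mat_apply_swap 0 1, A.mat_apply_swap 0 2, A.mat_apply_swap 0 3, A.mat_apply_swap 1 2,
    A.mat_apply_swap 1 3, A.mat_apply_swap 2 3, B.mat_apply_swap 0 1, B.mat_apply_swap 0 2,
    B.mat_apply_swap 0 3, B.mat_apply_swap 1 2, B.mat_apply_swap 1 3, B.mat_apply_swap 2 3, *]

/-- The inner product `⟨A, B⟩ = -½ tr (A B)` on `Λ² ℝ⁴`; see `inner_wedge` for its value on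
`x ∧ y`. -/
@[reducible] noncomputable def core : InnerProductSpace.Core ℝ Bivector where
  inner A B := -(1 / 2 : ℝ) * (A.mat * B.mat).trace
  conj_inner_symm A B := by
    simp only [conj_trivial]
    rw [Matrix.trace_mul_comm]
  re_inner_nonneg A := by
    rw [trace_mul]
    simp only [RCLike.re_to_real]
    nlinarith [mul_self_nonneg (A.mat 0 1), mul_self_nonneg (A.mat 0 2), mul_self_nonneg (A.mat 0 3),
      mul_self_nonneg (A.mat 1 2), mul_self_nonneg (A.mat 1 3), mul_self_nonneg (A.mat 2 3)]
  add_left A B C := by simp [Matrix.add_mul]; ring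
  smul_left A B r := by simp; ring
  definite A h := by
    rw [trace_mul] at h
    have h1 := mul_self_nonneg (A.mat 0 1)
    have h2 := mul_self_nonneg (A.mat 0 2)
    have h3 := mul_self_nonneg (A.mat 0 3)
    have h4 := mul_self_nonneg (A.mat 1 2)
    have h5 := mul_self_nonneg (A.mat 1 3)
    have h6 := mul_self_nonneg (A.mat 2 3)
    apply ext_entries <;> simp only [mat_zero, Matrix.zero_apply] <;>
      apply mul_self_eq_zero.1 <;> linarith

noncomputable instance : NormedAddCommGroup Bivector := core.toNormedAddCommGroup
noncomputable instance : InnerProductSpace ℝ Bivector := InnerProductSpace.ofCore core.toCore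
instance : FiniteDimensional ℝ Bivector :=
  inferInstanceAs (FiniteDimensional ℝ (LieAlgebra.Orthogonal.so (Fin 4) ℝ))

theorem inner_def (A B : Bivector) : inner ℝ A B = -(1 / 2 : ℝ) * (A.mat * B.mat).trace := rfl

theorem inner_eq (A B : Bivector) : inner ℝ A B =
    A.mat 0 1 * B.mat 0 1 + A.mat 0 2 * B.mat 0 2 + A.mat 0 3 * B.mat 0 3 +
    A.mat 1 2 * B.mat 1 2 + A.mat 1 3 * B.mat 1 3 + A.mat 2 3 * B.mat 2 3 := trace_mul A B

/-- The bivector `x ∧ y`. -/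
def wedge (x y : Fin 4 → ℝ) : Bivector :=
  ofMat (wedgeMatrix x y) (by
    ext i j
    simp [wedgeMatrix, vecMulVec_apply]
    ring)

theorem inner_wedge (x y z t : Fin 4 → ℝ) :
    inner ℝ (wedge x y) (wedge z t) = (x ⬝ᵥ z) * (y ⬝ᵥ t) - (x ⬝ᵥ t) * (y ⬝ᵥ z) := by
  rw [inner_eq]
  simp only [wedge, mat_ofMat, wedgeMatrix, vecMulVec_apply, Matrix.sub_apply, dotProduct,
    Fin.sum_univ_four]
  ring

/-- The Lie bracket `B ↦ [A, B]` of `Λ² ℝ⁴ = so(4, ℝ)`. -/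
def ad (A : Bivector) : Bivector →ₗ[ℝ] Bivector where
  toFun B := ofMat (A.mat * B.mat - B.mat * A.mat) (by
    simp [Matrix.transpose_mul, mat_transpose])
  map_add' B C := by
    apply ext
    simp [Matrix.mul_add, Matrix.add_mul]
    abel
  map_smul' c B := by
    apply ext
    simp [smul_sub]

/-- The Lie bracket as a bilinear map. -/
def adₗ : Bivector →ₗ[ℝ] Bivector →ₗ[ℝ] Bivector where
  toFun := ad
  map_add' B C := by
    ext D : 2
    simp [ad, Matrix.mul_add, Matrix.add_mul]
    abel
  map_smul' c B := by
    ext D : 2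
    simp [ad, smul_sub]

/-- The map `Λ² g`, with `x ∧ y ↦ g x ∧ g y` (see `conj_wedge`). -/
noncomputable def conj (g : Matrix (Fin 4) (Fin 4) ℝ) : Bivector →L[ℝ] Bivector :=
  LinearMap.toContinuousLinearMap
    { toFun := fun A => ofMat (g * A.mat * gᵀ) (by
        simp [Matrix.transpose_mul, mat_transpose, Matrix.mul_assoc])
      map_add' := fun A B => by
        apply ext
        simp [Matrix.mul_add, Matrix.add_mul]
      map_smul' := fun c A => by
        apply ext
        simp }

theorem conj_mat (g : Matrix (Fin 4) (Fin 4) ℝ) (A : Bivector) :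
    (conj g A).mat = g * A.mat * gᵀ := rfl

theorem conj_wedge (g : Matrix (Fin 4) (Fin 4) ℝ) (x y : Fin 4 → ℝ) :
    conj g (wedge x y) = wedge (g *ᵥ x) (g *ᵥ y) := by
  apply ext
  simp only [conj_mat, wedge, mat_ofMat, wedgeMatrix, Matrix.mul_sub, Matrix.sub_mul,
    Matrix.mul_vecMulVec, Matrix.vecMulVec_mul, Matrix.vecMul_transpose]

theorem inner_conj_transpose (g : Matrix (Fin 4) (Fin 4) ℝ) (A B : Bivector) :
    inner ℝ (conj gᵀ A) B = inner ℝ A (conj g B) := by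
  simp only [inner_def, conj_mat, Matrix.transpose_transpose]
  rw [Matrix.mul_assoc, Matrix.mul_assoc, Matrix.trace_mul_comm]
  simp only [Matrix.mul_assoc]

end Bivector

open Bivector

/-- The symmetric bilinear form `(η, ζ) ↦ -½ tr (ad η ∘ R ∘ ad ζ ∘ R)` on `Λ² ℝ⁴`. -/
noncomputable def sharpForm (R : Bivector →L[ℝ] Bivector) : Bivector →ₗ[ℝ] Bivector →ₗ[ℝ] ℝ :=
  LinearMap.mk₂ ℝ (fun η ζ => -(1 / 2 : ℝ) *
      LinearMap.trace ℝ Bivector (ad η ∘ₗ R.toLinearMap ∘ₗ ad ζ ∘ₗ R.toLinearMap))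
    (by
      intro a b c
      simp only [show ∀ x, ad x = adₗ x from fun _ => rfl, map_add, LinearMap.add_comp]
      ring)
    (by
      intro a b c
      simp only [show ∀ x, ad x = adₗ x from fun _ => rfl, map_smul, LinearMap.smul_comp, smul_eq_mul]
      ring)
    (by
      intro a b c
      simp only [show ∀ x, ad x = adₗ x from fun _ => rfl, map_add, LinearMap.add_comp, LinearMap.comp_add]
      ring)
    (by
      intro a b c
      simp only [show ∀ x, ad x = adₗ x from fun _ => rfl, map_smul, LinearMap.smul_comp, LinearMap.comp_smul, smul_eq_mul]
      ring)

/-- `R^#`: the symmetric operator with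
`⟨R^# η, η⟩ = -½ ∑ i, ⟨[η, R [η, R ωᵢ]], ωᵢ⟩` for every orthonormal basis `ω`
(see `inner_sharp_self`, and `sharpForm_comm` for the symmetry). -/
noncomputable def sharp (R : Bivector →L[ℝ] Bivector) : Bivector →L[ℝ] Bivector :=
  LinearMap.toContinuousLinearMap
    ((InnerProductSpace.toDual ℝ Bivector).symm.toLinearEquiv.toLinearMap ∘ₗ
      LinearMap.toContinuousLinearMap.toLinearMap ∘ₗ sharpForm R)

theorem inner_sharp (R : Bivector →L[ℝ] Bivector) (η ζ : Bivector) :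
    inner ℝ (sharp R η) ζ = sharpForm R η ζ := by
  simp [sharp]

theorem sharpForm_comm (R : Bivector →L[ℝ] Bivector) (η ζ : Bivector) :
    sharpForm R η ζ = sharpForm R ζ η := by
  simp only [sharpForm, LinearMap.mk₂_apply]
  congr 1
  exact LinearMap.trace_mul_comm ℝ (ad η ∘ₗ R.toLinearMap) (ad ζ ∘ₗ R.toLinearMap)

theorem inner_sharp_self {ι : Type*} [Fintype ι] (b : OrthonormalBasis ι ℝ Bivector)
    (R : Bivector →L[ℝ] Bivector) (η : Bivector) :
    inner ℝ (sharp R η) η = -(1 / 2 : ℝ) * ∑ i, inner ℝ (ad η (R (ad η (R (b i))))) (b i) := by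
  rw [inner_sharp, sharpForm, LinearMap.mk₂_apply, LinearMap.trace_eq_sum_inner _ b]
  simp [real_inner_comm]

namespace Bivector

/-- Coordinates on `Λ² ℝ⁴`. -/
noncomputable def coords : Bivector ≃ₗ[ℝ] EuclideanSpace ℝ (Fin 6) where
  toFun A := !₂[A.mat 0 1, A.mat 0 2, A.mat 0 3, A.mat 1 2, A.mat 1 3, A.mat 2 3]
  invFun v := ofMat !![0, v 0, v 1, v 2; -v 0, 0, v 3, v 4; -v 1, -v 3, 0, v 5; -v 2, -v 4, -v 5, 0] (by
    ext i j
    fin_cases i <;> fin_cases j <;> simp)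
  map_add' A B := by
    ext i
    fin_cases i <;> simp
  map_smul' c A := by
    ext i
    fin_cases i <;> simp
  left_inv A := by
    apply ext_entries <;> simp
  right_inv v := by
    ext i
    fin_cases i <;> simp

/-- The standard orthonormal basis of `Λ² ℝ⁴`. -/
noncomputable def stdBasis : OrthonormalBasis (Fin 6) ℝ Bivector :=
  OrthonormalBasis.ofRepr
    { coords with
      norm_map' := fun A => by
        rw [← sq_eq_sq₀ (norm_nonneg _) (norm_nonneg _), EuclideanSpace.norm_sq_eq,
          ← real_inner_self_eq_norm_sq, inner_eq]
        simp [coords, Fin.sum_univ_six]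
        ring }

/-- The matrix coefficients of an endomorphism. -/
noncomputable def coeff (R : Bivector →L[ℝ] Bivector) (k l : Fin 6) : ℝ :=
  inner ℝ (R (stdBasis k)) (stdBasis l)

theorem inner_map (R : Bivector →L[ℝ] Bivector) (A B : Bivector) : inner ℝ (R A) B =
    ∑ k, ∑ l, stdBasis.repr A k * stdBasis.repr B l * coeff R k l := by
  conv_lhs => rw [← stdBasis.sum_repr A, ← stdBasis.sum_repr B]
  simp only [map_sum, map_smul, sum_inner, inner_sum, real_inner_smul_left, real_inner_smul_right]
  rw [Finset.sum_comm]
  refine Finset.sum_congr rfl fun k _ => ?_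
  refine Finset.sum_congr rfl fun l _ => ?_
  rw [coeff]
  ring

theorem repr_eq (A : Bivector) (k : Fin 6) : stdBasis.repr A k =
  ![A.mat 0 1, A.mat 0 2, A.mat 0 3, A.mat 1 2, A.mat 1 3, A.mat 2 3] k := rfl

theorem mat_map (R : Bivector →L[ℝ] Bivector) (A : Bivector) (k : Fin 6) :
    stdBasis.repr (R A) k =
    ∑ n, stdBasis.repr A n * coeff R n k := by
  conv_lhs => rw [← stdBasis.sum_repr A]
  simp [OrthonormalBasis.repr_apply_apply, real_inner_comm, coeff]

theorem wedge_repr (x y : Fin 4 → ℝ) (k : Fin 6) : stdBasis.repr (wedge x y) k =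
   ![y 0 * x 1 - x 0 * y 1, y 0 * x 2 - x 0 * y 2, y 0 * x 3 - x 0 * y 3,
     y 1 * x 2 - x 1 * y 2, y 1 * x 3 - x 1 * y 3, y 2 * x 3 - x 2 * y 3] k := rfl

set_option linter.unusedSimpArgs false in
theorem ad_repr (A B : Bivector) (k : Fin 6) : stdBasis.repr (ad A B) k =
   (let a := stdBasis.repr A
    let b := stdBasis.repr B
    ![-a 1 * b 3 - a 2 * b 4 + b 1 * a 3 + b 2 * a 4,
      a 0 * b 3 - a 2 * b 5 - b 0 * a 3 + b 2 * a 5,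
      a 0 * b 4 + a 1 * b 5 - b 0 * a 4 - b 1 * a 5,
      -a 0 * b 1 + b 0 * a 1 - a 4 * b 5 + b 4 * a 5,
      -a 0 * b 2 + b 0 * a 2 + a 3 * b 5 - b 3 * a 5,
      -a 1 * b 2 + b 1 * a 2 - a 3 * b 4 + b 3 * a 4]) k := by
  simp only [repr_eq]
  fin_cases k <;>
  simp [ad, Matrix.mul_apply, Fin.sum_univ_four, mat_apply_self, A.mat_apply_swap 0 1,
    A.mat_apply_swap 0 2, A.mat_apply_swap 0 3, A.mat_apply_swap 1 2, A.mat_apply_swap 1 3,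
    A.mat_apply_swap 2 3, B.mat_apply_swap 0 1, B.mat_apply_swap 0 2, B.mat_apply_swap 0 3,
    B.mat_apply_swap 1 2, B.mat_apply_swap 1 3, B.mat_apply_swap 2 3] <;> ring

end Bivector

/-- `R` is a symmetric endomorphism of `Λ² ℝ⁴`. -/
def IsSym (R : Bivector →L[ℝ] Bivector) : Prop :=
  ∀ ω η : Bivector, inner ℝ (R ω) η = inner ℝ ω (R η)

/-- The first Bianchi identity. -/
def Bianchi (R : Bivector →L[ℝ] Bivector) : Prop :=
  ∀ x y z t : Fin 4 → ℝ, inner ℝ (R (wedge x y)) (wedge z t) +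
        inner ℝ (R (wedge z x)) (wedge y t) + inner ℝ (R (wedge y z)) (wedge x t) = 0

theorem IsSym.coeff {R : Bivector →L[ℝ] Bivector} (hR : IsSym R) (i j : Fin 6) :
    coeff R i j = coeff R j i := by
  rw [Bivector.coeff, Bivector.coeff, hR, real_inner_comm]

theorem bianchi_iff (R : Bivector →L[ℝ] Bivector) (hR : IsSym R) :
    Bianchi R ↔ coeff R 0 5 - coeff R 1 4 + coeff R 2 3 = 0 := by
  have key := hR.coeff
  constructor
  · intro h
    have h1 := h (Pi.single 0 1) (Pi.single 1 1) (Pi.single 2 1) (Pi.single 3 1)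
    simp only [inner_map, wedge_repr, Fin.sum_univ_six] at h1
    simp at h1
    rw [key 3 2] at h1
    linarith
  · intro h x y z t
    simp only [inner_map, wedge_repr, Fin.sum_univ_six]
    simp only [key 1 0, key 2 0, key 3 0, key 4 0, key 5 0, key 2 1, key 3 1, key 4 1, key 5 1,
      key 3 2, key 4 2, key 5 2, key 4 3, key 5 3, key 5 4]
    simp only [Matrix.cons_val]
    linear_combination ((x 0 * y 1 - x 1 * y 0) * (z 2 * t 3 - z 3 * t 2)
      - (x 0 * y 2 - x 2 * y 0) * (z 1 * t 3 - z 3 * t 1)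
      + (x 0 * y 3 - x 3 * y 0) * (z 1 * t 2 - z 2 * t 1)
      + (x 1 * y 2 - x 2 * y 1) * (z 0 * t 3 - z 3 * t 0)
      - (x 1 * y 3 - x 3 * y 1) * (z 0 * t 2 - z 2 * t 0)
      + (x 2 * y 3 - x 3 * y 2) * (z 0 * t 1 - z 1 * t 0)) * h

theorem sq_coeff (R : Bivector →L[ℝ] Bivector) (hR : IsSym R) (k l : Fin 6) :
    coeff (R.comp R) k l = ∑ m, coeff R k m * coeff R l m := by
  rw [Bivector.coeff, ContinuousLinearMap.comp_apply, hR,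
    ← stdBasis.sum_inner_mul_inner (R (stdBasis k)) (R (stdBasis l))]
  simp only [Bivector.coeff, real_inner_comm]

theorem sharp_coeff (R : Bivector →L[ℝ] Bivector) (k l : Fin 6) :
    coeff (sharp R) k l = -(1 / 2 : ℝ) *
      ∑ m, stdBasis.repr (ad (stdBasis k) (R (ad (stdBasis l) (R (stdBasis m))))) m := by
  rw [Bivector.coeff, inner_sharp, sharpForm, LinearMap.mk₂_apply,
    LinearMap.trace_eq_sum_inner _ stdBasis]
  simp [OrthonormalBasis.repr_apply_apply]

theorem Q_coeff_bianchi (R : Bivector →L[ℝ] Bivector) (hR : IsSym R) (hB : Bianchi R) :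
    coeff (R.comp R) 0 5 - coeff (R.comp R) 1 4 + coeff (R.comp R) 2 3 +
    (coeff (sharp R) 0 5 - coeff (sharp R) 1 4 + coeff (sharp R) 2 3) = 0 := by
  have key := hR.coeff
  have h : coeff R 0 5 = coeff R 1 4 - coeff R 2 3 := by
    linarith [(bianchi_iff R hR).1 hB]
  simp only [sq_coeff R hR, sharp_coeff]
  simp only [ad_repr, mat_map, Fin.sum_univ_six, OrthonormalBasis.repr_self,
    PiLp.single_apply]
  simp only [Matrix.cons_val]
  simp
  simp only [key 1 0, key 2 0, key 3 0, key 4 0, key 5 0, key 2 1, key 3 1, key 4 1, key 5 1,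
      key 3 2, key 4 2, key 5 2, key 4 3, key 5 3, key 5 4, h]
  ring

theorem Q_isSym (R : Bivector →L[ℝ] Bivector) (hR : IsSym R) : IsSym (R.comp R + sharp R) := by
  intro ω η
  rw [_root_.add_apply, _root_.add_apply, inner_add_left,
    inner_add_right, ContinuousLinearMap.comp_apply, ContinuousLinearMap.comp_apply, hR, hR,
    inner_sharp, real_inner_comm (sharp R η) ω, inner_sharp, sharpForm_comm]

theorem Q_bianchi (R : Bivector →L[ℝ] Bivector) (hR : IsSym R) (hB : Bianchi R) :
    Bianchi (R.comp R + sharp R) := by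
  rw [bianchi_iff _ (Q_isSym R hR)]
  have h := Q_coeff_bianchi R hR hB
  simp only [Bivector.coeff, _root_.add_apply, inner_add_left] at h ⊢
  linarith

/-- The space `S²_B Λ² ℝ⁴` of algebraic curvature operators. -/
def curvatureOperators : Submodule ℝ (Bivector →L[ℝ] Bivector) where
  carrier := {R | IsSym R ∧ Bianchi R}
  zero_mem' := ⟨fun _ _ => by simp, fun _ _ _ _ => by simp⟩
  add_mem' := by
    rintro R S ⟨hR, hR'⟩ ⟨hS, hS'⟩
    refine ⟨fun ω η => ?_, fun x y z t => ?_⟩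
    · simp only [_root_.add_apply, inner_add_left, inner_add_right, hR ω η, hS ω η]
    · have h1 := hR' x y z t
      have h2 := hS' x y z t
      simp only [_root_.add_apply, inner_add_left]
      linarith
  smul_mem' := by
    rintro c R ⟨hR, hR'⟩
    refine ⟨fun ω η => ?_, fun x y z t => ?_⟩
    · simp only [_root_.smul_apply, real_inner_smul_left, real_inner_smul_right,
        hR ω η]
    · have h1 := hR' x y z t
      simp only [_root_.smul_apply, real_inner_smul_left]
      linear_combination c * h1

/-- The type of algebraic curvature operators. It is a finite-dimensional normed space, and
interiors, frontiers and tangent cones below are taken in it. -/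
abbrev CurvOp : Type := curvatureOperators

/-- The identity operator of `Λ² ℝ⁴`. -/
noncomputable def idOp : CurvOp :=
  ⟨ContinuousLinearMap.id ℝ Bivector, fun _ _ => rfl, fun x y z t => by
    simp only [ContinuousLinearMap.id_apply, inner_wedge, dotProduct, Fin.sum_univ_four]
    ring⟩

/-- The scalar curvature, twice the trace. -/
noncomputable def scal (R : CurvOp) : ℝ :=
  2 * LinearMap.trace ℝ Bivector R.1.toLinearMap

/-- The quadratic vector field `Q (R) = R² + R^#`. -/
noncomputable def Q (R : CurvOp) : CurvOp :=
  ⟨R.1.comp R.1 + sharp R.1, Q_isSym R.1 R.2.1, Q_bianchi R.1 R.2.1 R.2.2⟩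

/-- The operator `g.R` with `⟨g.R (x ∧ y), z ∧ t⟩ = ⟨R (gx ∧ gy), gz ∧ gt⟩`
(see `inner_act`). -/
noncomputable def act (g : Matrix (Fin 4) (Fin 4) ℝ) (R : CurvOp) : CurvOp :=
  ⟨(conj gᵀ).comp (R.1.comp (conj g)), by
    intro ω η
    simp only [ContinuousLinearMap.comp_apply, inner_conj_transpose]
    rw [R.2.1, ← real_inner_comm, ← inner_conj_transpose, real_inner_comm], by
    intro x y z t
    simp only [ContinuousLinearMap.comp_apply, inner_conj_transpose, conj_wedge]
    exact R.2.2 _ _ _ _⟩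

theorem inner_act (g : Matrix (Fin 4) (Fin 4) ℝ) (R : CurvOp) (x y z t : Fin 4 → ℝ) :
    inner ℝ ((act g R).1 (wedge x y)) (wedge z t) =
      inner ℝ (R.1 (wedge (g *ᵥ x) (g *ᵥ y))) (wedge (g *ᵥ z) (g *ᵥ t)) := by
  simp only [act, ContinuousLinearMap.comp_apply, inner_conj_transpose, conj_wedge]

/-! ### Curvature cones -/

/-- Curvature cones with symmetry group `G`: closed convex cones of algebraic curvature operators
that are invariant under `G` and contain the identity in their interior. -/
structure IsCurvatureCone (G : Set (Matrix (Fin 4) (Fin 4) ℝ)) (C : Set CurvOp) : Prop where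
  isClosed : IsClosed C
  convex : Convex ℝ C
  smul_mem : ∀ c : ℝ, 0 < c → ∀ R ∈ C, c • R ∈ C
  act_mem : ∀ g ∈ G, ∀ R ∈ C, act g R ∈ C
  id_mem_interior : idOp ∈ interior C

/-- Oriented curvature cones are invariant under `SO(4)`. -/
def IsOrientedCurvatureCone (C : Set CurvOp) : Prop :=
  IsCurvatureCone (Matrix.specialOrthogonalGroup (Fin 4) ℝ) C

/-- Unoriented curvature cones are invariant under `O(4)`. -/
def IsUnorientedCurvatureCone (C : Set CurvOp) : Prop :=
  IsCurvatureCone (Matrix.orthogonalGroup (Fin 4) ℝ) C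

/-- `C` is Ricci flow invariant: at each boundary point `R` of `C`, the vector `Q (R)` lies in the
tangent cone of `C` at `R`. -/
def IsRicciFlowInvariant (C : Set CurvOp) : Prop :=
  ∀ R ∈ frontier C, Q R ∈ posTangentConeAt C R

/-- The cone of operators with nonnegative scalar curvature. -/
def scalCone : Set CurvOp := {R | 0 ≤ scal R}

/-! ### Isotropic curvature -/

/-- `Λ² ℝ⁴ ⊗ ℂ = Λ² ℂ⁴`, realised as `so(4, ℂ)`. -/
abbrev ComplexBivector : Type := LieAlgebra.Orthogonal.so (Fin 4) ℂ

/-- The complex bivector `v ∧ w`. -/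
def complexWedge (v w : Fin 4 → ℂ) : ComplexBivector :=
  ⟨wedgeMatrix v w, (LieAlgebra.Orthogonal.mem_so _ _ _).2 (by
    ext i j
    simp [wedgeMatrix, vecMulVec_apply]
    ring)⟩

theorem complexBivector_apply (Z : ComplexBivector) (i j : Fin 4) : Z.1 j i = -Z.1 i j :=
  congrFun (congrFun ((LieAlgebra.Orthogonal.mem_so _ _ _).1 Z.2) i) j

/-- The real part of a complex bivector. -/
def rePart (Z : ComplexBivector) : Bivector :=
  ofMat (Z.1.map Complex.re) (by
    ext i j
    simp [complexBivector_apply Z i j])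

/-- The imaginary part of a complex bivector. -/
def imPart (Z : ComplexBivector) : Bivector :=
  ofMat (Z.1.map Complex.im) (by
    ext i j
    simp [complexBivector_apply Z i j])

/-- The complex bivector `A + i B`. -/
noncomputable def mkComplex (A B : Bivector) : ComplexBivector :=
  ⟨A.mat.map Complex.ofReal + Complex.I • B.mat.map Complex.ofReal,
    (LieAlgebra.Orthogonal.mem_so _ _ _).2 (by
      ext i j
      simp [A.mat_apply_swap i j, B.mat_apply_swap i j]
      ring)⟩

/-- The complex linear extension of a real operator `R` to `Λ² ℝ⁴ ⊗ ℂ`. -/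
noncomputable def complexExtension (R : Bivector →L[ℝ] Bivector) (Z : ComplexBivector) : ComplexBivector :=
  mkComplex (R (rePart Z)) (R (imPart Z))

/-- The Hermitian extension to `Λ² ℝ⁴ ⊗ ℂ` of the inner product of `Λ² ℝ⁴`. -/
noncomputable def hermitian (Z W : ComplexBivector) : ℂ := (1 / 2 : ℂ) * (Z.1 * W.1ᴴ).trace

theorem mkComplex_rePart_imPart (Z : ComplexBivector) : mkComplex (rePart Z) (imPart Z) = Z := by
  apply Subtype.ext
  ext i j
  simp [mkComplex, rePart, imPart, mul_comm Complex.I, Complex.re_add_im]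

theorem hermitian_mkComplex (A B C D : Bivector) :
    hermitian (mkComplex A B) (mkComplex C D) =
      ((inner ℝ A C + inner ℝ B D : ℝ) : ℂ) + ((inner ℝ B C - inner ℝ A D : ℝ) : ℂ) * Complex.I := by
  have hm : ∀ M N : Matrix (Fin 4) (Fin 4) ℝ,
      (M.map Complex.ofReal * N.map Complex.ofReal).trace = (((M * N).trace : ℝ) : ℂ) := by
    intro M N
    simp [Matrix.trace, Matrix.mul_apply]
  have hc : (mkComplex C D).1ᴴ =
      -C.mat.map Complex.ofReal + Complex.I • D.mat.map Complex.ofReal := by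
    ext i j
    simp [mkComplex, C.mat_apply_swap i j, D.mat_apply_swap i j]
  rw [hermitian, hc]
  simp only [mkComplex, Matrix.add_mul, Matrix.mul_add, Matrix.mul_neg, Matrix.smul_mul,
    Matrix.mul_smul, Matrix.trace_add, Matrix.trace_neg, Matrix.trace_smul, hm, smul_eq_mul,
    inner_def]
  push_cast
  linear_combination (1 / 2 : ℂ) * ((B.mat * D.mat).trace : ℂ) * Complex.I_sq

/-- The number `⟨R Z, Z⟩` is real, and equals `⟨R A, A⟩ + ⟨R B, B⟩` for `Z = A + i B`. -/
theorem hermitian_complexExtension (R : CurvOp) (Z : ComplexBivector) :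
    hermitian (complexExtension R.1 Z) Z =
      ((inner ℝ (R.1 (rePart Z)) (rePart Z) + inner ℝ (R.1 (imPart Z)) (imPart Z) : ℝ) : ℂ) := by
  conv_lhs => rw [← mkComplex_rePart_imPart Z]
  rw [complexExtension, hermitian_mkComplex, mkComplex_rePart_imPart, R.2.1 (imPart Z) (rePart Z),
    real_inner_comm (R.1 (rePart Z)) (imPart Z)]
  simp

/-- `v` and `w` span a complex plane on which the complex bilinear extension of the Euclidean
inner product vanishes. -/
def SpanIsotropicPlane (v w : Fin 4 → ℂ) : Prop :=
  LinearIndependent ℂ ![v, w] ∧ v ⬝ᵥ v = 0 ∧ v ⬝ᵥ w = 0 ∧ w ⬝ᵥ w = 0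

/-- The Hodge star on bivectors, for the standard orientation: it is the linear map with
`⋆ (eᵢ ∧ eⱼ) = eₖ ∧ eₗ` for every even permutation `(i, j, k, l)` of the four indices. -/
def hodgeStar (A : Matrix (Fin 4) (Fin 4) ℂ) : Matrix (Fin 4) (Fin 4) ℂ :=
  !![0, A 2 3, A 3 1, A 1 2;
     A 3 2, 0, A 0 3, A 2 0;
     A 1 3, A 3 0, 0, A 0 1;
     A 2 1, A 0 2, A 1 0, 0]

/-- Complex self-dual bivectors. -/
def IsSelfDual (Z : ComplexBivector) : Prop := hodgeStar Z.1 = Z.1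

/-- Complex anti-self-dual bivectors. -/
def IsAntiSelfDual (Z : ComplexBivector) : Prop := hodgeStar Z.1 = -Z.1

/-- Nonnegative isotropic curvature on self-dual bivectors. -/
def nnicPlus : Set CurvOp :=
  {R | ∀ v w : Fin 4 → ℂ, SpanIsotropicPlane v w → IsSelfDual (complexWedge v w) →
    0 ≤ (hermitian (complexExtension R.1 (complexWedge v w)) (complexWedge v w)).re}

/-- Nonnegative isotropic curvature on anti-self-dual bivectors. -/
def nnicMinus : Set CurvOp :=
  {R | ∀ v w : Fin 4 → ℂ, SpanIsotropicPlane v w → IsAntiSelfDual (complexWedge v w) →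
    0 ≤ (hermitian (complexExtension R.1 (complexWedge v w)) (complexWedge v w)).re}

/-- Nonnegative isotropic curvature. -/
def nnic : Set CurvOp :=
  {R | ∀ v w : Fin 4 → ℂ, SpanIsotropicPlane v w →
    0 ≤ (hermitian (complexExtension R.1 (complexWedge v w)) (complexWedge v w)).re}

end HalfPIC

namespace HalfPIC

open Matrix hiding stdBasis
open Bivector Topology

/-! Self-dual and anti-self-dual bivectors split so(4) into two commuting copies of so(3). A
curvature operator becomes a triple of 3×3 blocks (A, B, D) with A and D symmetric; the Bianchi
identity reads tr A = tr D, and the scalar curvature is 4 tr A. SO(4) rotates the two factors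
independently, a reflection exchanges them, and Q takes Hamilton's form A² + BBᵀ + 2 adj A, AB + BD
+ 2 (adj B)ᵀ, D² + BᵀB + 2 adj D (`hasBlocks_Q`). A self-dual isotropic v ∧ w is x + iy with x, y
orthogonal of equal length in Λ⁺, so NNIC₊ says that tr A − ⟨An, n⟩ ≥ 0 for all unit n: the two
smallest eigenvalues of A have nonnegative sum (`mem_nnicPlus_iff`).

The engine of the classification is convex duality. If f ≥ 0 on C, f(Id) = 1 and f(S) = 0 with S in
C, then f(Q(S)) ≥ 0 (`IsRicciFlowInvariant.apply_Q_nonneg`); such S and f exist where a ray from Id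
leaves C (`exists_exit`). Suppose C is not inside NNIC₊. Averaging a bad operator over rotations
gives, up to scale, either W = (diag(−1, −1, 2), 0, 0) or Id + tW with t > 1. In the second case, if
W were not in C, the ray would exit at some τ > 1 and Q(Id + τW) = 3 Id + 3τ²W would have f-value 3
− 3τ < 0. So W lies in C (`mem_weyl`); its rotations span the traceless A-blocks, and C contains
that whole space (`lineMem_weyl`).

If C is not inside NNIC₋ either, reflection gives the same for D. A second exit argument, sheared by
an element of the lines already obtained, puts the mixed blocks in C (`mem_ricci`), whence C
contains all of the scalar curvature cone (`scalCone_subset`), a contradiction. An O(4)-invariant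
cone is its own mirror image, so it lies in both half cones.

Finally NNIC₊ is itself invariant because R + hQ(R) stays in it for small h ≥ 0
(`TwoNonneg.exists_add_smul`). Maximality follows from the dichotomy and the fact that neither half
cone contains the other. -/

/-! ### Block decomposition along Λ⁺ ⊕ Λ⁻ -/

/-- The orthogonal basis of the self-dual bivectors, whose vectors have squared norm `2`. -/
noncomputable def sd : Fin 3 → Bivector :=
  ![stdBasis 0 + stdBasis 5, stdBasis 1 - stdBasis 4, stdBasis 2 + stdBasis 3]

/-- The orthogonal basis of the anti-self-dual bivectors, whose vectors have squared norm `2`. -/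
noncomputable def asd : Fin 3 → Bivector :=
  ![-stdBasis 0 + stdBasis 5, -stdBasis 1 - stdBasis 4, -stdBasis 2 + stdBasis 3]

/-- The self-dual block of a curvature operator. -/
noncomputable def blockA (R : CurvOp) : Matrix (Fin 3) (Fin 3) ℝ :=
  of fun i j => (1 / 2 : ℝ) * inner ℝ (R.1 (sd i)) (sd j)

/-- The mixed block of a curvature operator. -/
noncomputable def blockB (R : CurvOp) : Matrix (Fin 3) (Fin 3) ℝ :=
  of fun i j => (1 / 2 : ℝ) * inner ℝ (R.1 (sd i)) (asd j)

/-- The anti-self-dual block of a curvature operator. -/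
noncomputable def blockD (R : CurvOp) : Matrix (Fin 3) (Fin 3) ℝ :=
  of fun i j => (1 / 2 : ℝ) * inner ℝ (R.1 (asd i)) (asd j)

/-- The block decomposition of a curvature operator along `Λ² = Λ⁺ ⊕ Λ⁻`. -/
structure HasBlocks (R : CurvOp) (A B D : Matrix (Fin 3) (Fin 3) ℝ) : Prop where
  blockA_eq : blockA R = A
  blockB_eq : blockB R = B
  blockD_eq : blockD R = D

theorem hasBlocks (R : CurvOp) : HasBlocks R (blockA R) (blockB R) (blockD R) := ⟨rfl, rfl, rfl⟩

theorem coeff_def (R : Bivector →L[ℝ] Bivector) (k l : Fin 6) :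
    inner ℝ (R (stdBasis k)) (stdBasis l) = coeff R k l := rfl

theorem blockA_coeff (R : CurvOp) : blockA R = (1 / 2 : ℝ) •
    !![coeff R.1 0 0 + 2 * coeff R.1 0 5 + coeff R.1 5 5,
        coeff R.1 0 1 - coeff R.1 0 4 + coeff R.1 1 5 - coeff R.1 4 5,
        coeff R.1 0 2 + coeff R.1 0 3 + coeff R.1 2 5 + coeff R.1 3 5;
      coeff R.1 0 1 - coeff R.1 0 4 + coeff R.1 1 5 - coeff R.1 4 5,
        coeff R.1 1 1 - 2 * coeff R.1 1 4 + coeff R.1 4 4,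
        coeff R.1 1 2 + coeff R.1 1 3 - coeff R.1 2 4 - coeff R.1 3 4;
      coeff R.1 0 2 + coeff R.1 0 3 + coeff R.1 2 5 + coeff R.1 3 5,
        coeff R.1 1 2 + coeff R.1 1 3 - coeff R.1 2 4 - coeff R.1 3 4,
        coeff R.1 2 2 + 2 * coeff R.1 2 3 + coeff R.1 3 3] := by
  have key := R.2.1.coeff
  ext i j
  fin_cases i <;> fin_cases j <;>
    simp [blockA, sd, inner_add_left, inner_add_right, inner_sub_left, inner_sub_right, coeff_def] <;>
    simp only [key 1 0, key 2 0, key 3 0, key 4 0, key 5 0, key 2 1, key 3 1, key 4 1, key 5 1,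
      key 3 2, key 4 2, key 5 2, key 4 3, key 5 3, key 5 4] <;> ring

theorem blockD_coeff (R : CurvOp) : blockD R = (1 / 2 : ℝ) •
    !![coeff R.1 0 0 - 2 * coeff R.1 0 5 + coeff R.1 5 5,
        coeff R.1 0 1 + coeff R.1 0 4 - coeff R.1 1 5 - coeff R.1 4 5,
        coeff R.1 0 2 - coeff R.1 0 3 - coeff R.1 2 5 + coeff R.1 3 5;
      coeff R.1 0 1 + coeff R.1 0 4 - coeff R.1 1 5 - coeff R.1 4 5,
        coeff R.1 1 1 + 2 * coeff R.1 1 4 + coeff R.1 4 4,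
        coeff R.1 1 2 - coeff R.1 1 3 + coeff R.1 2 4 - coeff R.1 3 4;
      coeff R.1 0 2 - coeff R.1 0 3 - coeff R.1 2 5 + coeff R.1 3 5,
        coeff R.1 1 2 - coeff R.1 1 3 + coeff R.1 2 4 - coeff R.1 3 4,
        coeff R.1 2 2 - 2 * coeff R.1 2 3 + coeff R.1 3 3] := by
  have key := R.2.1.coeff
  ext i j
  fin_cases i <;> fin_cases j <;>
    simp [blockD, asd, inner_add_left, inner_add_right, inner_sub_left, inner_sub_right, coeff_def] <;>
    simp only [key 1 0, key 2 0, key 3 0, key 4 0, key 5 0, key 2 1, key 3 1, key 4 1, key 5 1,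
      key 3 2, key 4 2, key 5 2, key 4 3, key 5 3, key 5 4] <;> ring

theorem blockA_transpose (R : CurvOp) : (blockA R)ᵀ = blockA R := by
  rw [blockA_coeff]
  ext i j
  fin_cases i <;> fin_cases j <;> rfl

theorem blockD_transpose (R : CurvOp) : (blockD R)ᵀ = blockD R := by
  rw [blockD_coeff]
  ext i j
  fin_cases i <;> fin_cases j <;> rfl

theorem trace_blockA (R : CurvOp) : (blockA R).trace = (1 / 4 : ℝ) * scal R := by
  rw [scal, LinearMap.trace_eq_sum_inner _ stdBasis, blockA_coeff]
  have h := (bianchi_iff R.1 R.2.1).1 R.2.2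
  simp only [real_inner_comm (R.1 _) (stdBasis _), Fin.sum_univ_six, ContinuousLinearMap.coe_coe, coeff_def]
  simp [Matrix.trace_fin_three]
  linarith

/-- For a symmetric operator this equality of traces is the whole content of the Bianchi identity;
`exists_hasBlocks` uses the converse. -/
theorem trace_blockD (R : CurvOp) : (blockD R).trace = (blockA R).trace := by
  rw [blockA_coeff, blockD_coeff]
  have h := (bianchi_iff R.1 R.2.1).1 R.2.2
  simp [Matrix.trace_fin_three]
  linarith

theorem curvOp_ext {R S : CurvOp} (h : ∀ k l : Fin 6, coeff R.1 k l = coeff S.1 k l) : R = S := by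
  apply Subtype.ext
  ext1 X
  refine ext_inner_right ℝ fun Y => ?_
  rw [inner_map, inner_map]
  simp only [h]

theorem exists_stdBasis_eq (k : Fin 6) : ∃ (i : Fin 3) (a b : ℝ), stdBasis k = a • sd i + b • asd i := by
  fin_cases k
  · exact ⟨0, 1 / 2, -1 / 2, by simp [sd, asd]; module⟩
  · exact ⟨1, 1 / 2, -1 / 2, by simp [sd, asd]; module⟩
  · exact ⟨2, 1 / 2, -1 / 2, by simp [sd, asd]; module⟩
  · exact ⟨2, 1 / 2, 1 / 2, by simp [sd, asd]; module⟩
  · exact ⟨1, -1 / 2, -1 / 2, by simp [sd, asd]; module⟩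
  · exact ⟨0, 1 / 2, 1 / 2, by simp [sd, asd]; module⟩

theorem inner_sd_sd (R : CurvOp) (i j : Fin 3) : inner ℝ (R.1 (sd i)) (sd j) = 2 * blockA R i j := by
  simp [blockA]

theorem inner_sd_asd (R : CurvOp) (i j : Fin 3) : inner ℝ (R.1 (sd i)) (asd j) = 2 * blockB R i j := by
  simp [blockB]

theorem inner_asd_sd (R : CurvOp) (i j : Fin 3) : inner ℝ (R.1 (asd i)) (sd j) = 2 * blockB R j i := by
  rw [R.2.1, real_inner_comm, inner_sd_asd]

theorem inner_asd_asd (R : CurvOp) (i j : Fin 3) :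
    inner ℝ (R.1 (asd i)) (asd j) = 2 * blockD R i j := by
  simp [blockD]

theorem HasBlocks.ext {R S : CurvOp} {A B D : Matrix (Fin 3) (Fin 3) ℝ} (hR : HasBlocks R A B D)
    (hS : HasBlocks S A B D) : R = S := by
  refine curvOp_ext fun k l => ?_
  obtain ⟨i, a, b, hi⟩ := exists_stdBasis_eq k
  obtain ⟨j, c, d, hj⟩ := exists_stdBasis_eq l
  simp only [← coeff_def, hi, hj, map_add, map_smul, inner_add_left, inner_add_right,
    real_inner_smul_left, real_inner_smul_right, inner_sd_sd, inner_sd_asd, inner_asd_sd,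
    inner_asd_asd, hR.blockA_eq, hR.blockB_eq, hR.blockD_eq, hS.blockA_eq, hS.blockB_eq,
    hS.blockD_eq]

theorem trace_eq_sum_sd (T : Bivector →ₗ[ℝ] Bivector) : LinearMap.trace ℝ Bivector T =
    (1 / 2 : ℝ) * (∑ i, inner ℝ (T (sd i)) (sd i) + ∑ i, inner ℝ (T (asd i)) (asd i)) := by
  rw [LinearMap.trace_eq_sum_inner _ stdBasis]
  simp only [Fin.sum_univ_six, Fin.sum_univ_three, real_inner_comm (T _) (stdBasis _)]
  simp [sd, asd, inner_add_left, inner_add_right, inner_sub_left, inner_sub_right]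
  ring

theorem inner_sd (i j : Fin 3) : inner ℝ (sd i) (sd j) = if i = j then (2 : ℝ) else 0 := by
  fin_cases i <;> fin_cases j <;>
    simp [sd, inner_add_left, inner_add_right, inner_sub_left, inner_sub_right,
      OrthonormalBasis.inner_eq_ite, -inner_self_eq_norm_sq_to_K] <;>
    norm_num

theorem inner_sd_asd_eq_zero (i j : Fin 3) : inner ℝ (sd i) (asd j) = (0 : ℝ) := by
  fin_cases i <;> fin_cases j <;>
    simp [sd, asd, inner_add_left, inner_add_right, inner_sub_left, inner_sub_right]

theorem inner_asd (i j : Fin 3) : inner ℝ (asd i) (asd j) = if i = j then (2 : ℝ) else 0 := by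
  fin_cases i <;> fin_cases j <;>
    simp [asd, inner_add_left, inner_add_right, inner_sub_left, inner_sub_right,
      OrthonormalBasis.inner_eq_ite, -inner_self_eq_norm_sq_to_K] <;>
    norm_num

theorem eq_sum_sd (X : Bivector) : X = (1 / 2 : ℝ) • (∑ i, (inner ℝ X (sd i) : ℝ) • sd i +
    ∑ i, (inner ℝ X (asd i) : ℝ) • asd i) := by
  conv_lhs => rw [← stdBasis.sum_repr X]
  simp only [OrthonormalBasis.repr_apply_apply, Fin.sum_univ_six, Fin.sum_univ_three]
  simp [sd, asd, inner_add_right, inner_sub_right, real_inner_comm]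
  module

theorem inner_eq_sum_sd (X Y : Bivector) : inner ℝ X Y = (1 / 2 : ℝ) *
    (∑ i, inner ℝ X (sd i) * inner ℝ Y (sd i) + ∑ i, inner ℝ X (asd i) * inner ℝ Y (asd i)) := by
  conv_lhs => rw [eq_sum_sd Y]
  simp only [inner_add_right, real_inner_smul_right, inner_sum, mul_add]
  simp only [mul_comm]

theorem map_sd (R : CurvOp) (i : Fin 3) :
    R.1 (sd i) = ∑ j, blockA R i j • sd j + ∑ j, blockB R i j • asd j := by
  rw [eq_sum_sd (R.1 (sd i))]
  simp only [inner_sd_sd, inner_sd_asd, mul_smul, ← Finset.smul_sum]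
  module

theorem map_asd (R : CurvOp) (i : Fin 3) :
    R.1 (asd i) = ∑ j, blockB R j i • sd j + ∑ j, blockD R i j • asd j := by
  rw [eq_sum_sd (R.1 (asd i))]
  simp only [inner_asd_sd, inner_asd_asd, mul_smul, ← Finset.smul_sum]
  module

/-! ### The bracket of so(4) and the vector field Q in blocks -/

/-- The structure constants of `so(3)`. -/
def crossMatrix (k : Fin 3) : Matrix (Fin 3) (Fin 3) ℝ :=
  ![!![0, 0, 0; 0, 0, 1; 0, -1, 0], !![0, 0, -1; 0, 0, 0; 1, 0, 0], !![0, 1, 0; -1, 0, 0; 0, 0, 0]] k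

theorem stdBasis_repr (k l : Fin 6) : stdBasis.repr (stdBasis k) l = if l = k then 1 else 0 := by
  simp [OrthonormalBasis.repr_self]

theorem ad_sd_sd (i j : Fin 3) : ad (sd i) (sd j) = (-2 : ℝ) • ∑ k, crossMatrix i j k • sd k := by
  apply stdBasis.repr.injective
  ext l
  rw [ad_repr]
  fin_cases i <;> fin_cases j <;> fin_cases l <;>
    simp [sd, crossMatrix, stdBasis_repr, Fin.sum_univ_three, -OrthonormalBasis.repr_self] <;> norm_num

theorem ad_asd_asd (i j : Fin 3) : ad (asd i) (asd j) = (-2 : ℝ) • ∑ k, crossMatrix i j k • asd k := by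
  apply stdBasis.repr.injective
  ext l
  rw [ad_repr]
  fin_cases i <;> fin_cases j <;> fin_cases l <;>
    simp [asd, crossMatrix, stdBasis_repr, Fin.sum_univ_three, -OrthonormalBasis.repr_self] <;> norm_num

/-- The two so(3) factors commute. This is why no block of R^# mixes A, B and D. -/
theorem ad_sd_asd (i j : Fin 3) : ad (sd i) (asd j) = 0 := by
  apply stdBasis.repr.injective
  ext l
  rw [ad_repr]
  fin_cases i <;> fin_cases j <;> fin_cases l <;>
    simp [sd, asd, stdBasis_repr, -OrthonormalBasis.repr_self]

theorem ad_asd_sd (i j : Fin 3) : ad (asd i) (sd j) = 0 := by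
  apply stdBasis.repr.injective
  ext l
  rw [ad_repr]
  fin_cases i <;> fin_cases j <;> fin_cases l <;>
    simp [sd, asd, stdBasis_repr, -OrthonormalBasis.repr_self]

theorem inner_comp_self (R : CurvOp) (X Y : Bivector) :
    inner ℝ ((R.1.comp R.1) X) Y = inner ℝ (R.1 X) (R.1 Y) := by
  rw [ContinuousLinearMap.comp_apply, R.2.1]

theorem blockA_comp_self (R : CurvOp) (i j : Fin 3) : inner ℝ ((R.1.comp R.1) (sd i)) (sd j) =
    2 * (blockA R * blockA R + blockB R * (blockB R)ᵀ) i j := by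
  have h := fun i j => congrFun (congrFun (blockA_transpose R) i) j
  simp only [transpose_apply] at h
  rw [inner_comp_self, inner_eq_sum_sd]
  simp only [inner_sd_sd, inner_sd_asd, Matrix.add_apply, Matrix.mul_apply, transpose_apply,
    Fin.sum_univ_three, h _ j]
  ring

theorem blockB_comp_self (R : CurvOp) (i j : Fin 3) : inner ℝ ((R.1.comp R.1) (sd i)) (asd j) =
    2 * (blockA R * blockB R + blockB R * blockD R) i j := by
  have h := fun i j => congrFun (congrFun (blockD_transpose R) i) j
  simp only [transpose_apply] at h
  rw [inner_comp_self, inner_eq_sum_sd]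
  simp only [inner_sd_sd, inner_sd_asd, inner_asd_sd, inner_asd_asd, Matrix.add_apply,
    Matrix.mul_apply, Fin.sum_univ_three, h _ j]
  ring

theorem blockD_comp_self (R : CurvOp) (i j : Fin 3) : inner ℝ ((R.1.comp R.1) (asd i)) (asd j) =
    2 * (blockD R * blockD R + (blockB R)ᵀ * blockB R) i j := by
  have h := fun i j => congrFun (congrFun (blockD_transpose R) i) j
  simp only [transpose_apply] at h
  rw [inner_comp_self, inner_eq_sum_sd]
  simp only [inner_asd_sd, inner_asd_asd, Matrix.add_apply, Matrix.mul_apply, transpose_apply,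
    Fin.sum_univ_three, h _ j]
  ring

theorem sum_smul_sum_smul (a : Fin 3 → ℝ) (M : Matrix (Fin 3) (Fin 3) ℝ) (v : Fin 3 → Bivector) :
    ∑ k, a k • ∑ m, M k m • v m = ∑ m, (a ᵥ* M) m • v m := by
  simp only [Finset.smul_sum, smul_smul, vecMul, dotProduct, Finset.sum_smul]
  exact Finset.sum_comm

theorem vecMul_eq_mul_apply (M N : Matrix (Fin 3) (Fin 3) ℝ) (i j : Fin 3) :
    (M i ᵥ* N) j = (M * N) i j := rfl

theorem ad_sd_map_sd (R : CurvOp) (j q : Fin 3) : ad (sd j) (R.1 (sd q)) =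
    (-2 : ℝ) • ∑ m, (blockA R * crossMatrix j) q m • sd m := by
  rw [map_sd]
  simp only [map_add, map_sum, map_smul, ad_sd_sd, ad_sd_asd, smul_zero, Finset.sum_const_zero,
    add_zero, smul_comm _ (-2 : ℝ), ← Finset.smul_sum, sum_smul_sum_smul]
  rfl

theorem ad_asd_map_sd (R : CurvOp) (j q : Fin 3) : ad (asd j) (R.1 (sd q)) =
    (-2 : ℝ) • ∑ m, (blockB R * crossMatrix j) q m • asd m := by
  rw [map_sd]
  simp only [map_add, map_sum, map_smul, ad_asd_asd, ad_asd_sd, smul_zero, Finset.sum_const_zero,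
    zero_add, smul_comm _ (-2 : ℝ), ← Finset.smul_sum, sum_smul_sum_smul]
  rfl

theorem ad_sd_map_asd (R : CurvOp) (j q : Fin 3) : ad (sd j) (R.1 (asd q)) =
    (-2 : ℝ) • ∑ m, ((blockB R)ᵀ * crossMatrix j) q m • sd m := by
  rw [map_asd]
  simp only [map_add, map_sum, map_smul, ad_sd_sd, ad_sd_asd, smul_zero, Finset.sum_const_zero,
    add_zero, smul_comm _ (-2 : ℝ), ← Finset.smul_sum]
  rw [sum_smul_sum_smul (fun k => blockB R k q)]
  rfl

theorem ad_asd_map_asd (R : CurvOp) (j q : Fin 3) : ad (asd j) (R.1 (asd q)) =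
    (-2 : ℝ) • ∑ m, (blockD R * crossMatrix j) q m • asd m := by
  rw [map_asd]
  simp only [map_add, map_sum, map_smul, ad_asd_asd, ad_asd_sd, smul_zero, Finset.sum_const_zero,
    zero_add, smul_comm _ (-2 : ℝ), ← Finset.smul_sum, sum_smul_sum_smul]
  rfl

theorem inner_asd_sd_eq_zero (i j : Fin 3) : inner ℝ (asd i) (sd j) = (0 : ℝ) := by
  rw [real_inner_comm, inner_sd_asd_eq_zero]

theorem ad_sd_map_sum_sd (R : CurvOp) (j : Fin 3) (c : Fin 3 → ℝ) :
    ad (sd j) (R.1 (∑ q, c q • sd q)) = (-2 : ℝ) • ∑ m, (c ᵥ* (blockA R * crossMatrix j)) m • sd m := by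
  simp only [map_sum, map_smul, ad_sd_map_sd, smul_comm _ (-2 : ℝ), ← Finset.smul_sum, sum_smul_sum_smul]

theorem ad_sd_map_sum_asd (R : CurvOp) (j : Fin 3) (c : Fin 3 → ℝ) :
    ad (sd j) (R.1 (∑ q, c q • asd q)) = (-2 : ℝ) • ∑ m, (c ᵥ* ((blockB R)ᵀ * crossMatrix j)) m • sd m := by
  simp only [map_sum, map_smul, ad_sd_map_asd, smul_comm _ (-2 : ℝ), ← Finset.smul_sum, sum_smul_sum_smul]

theorem ad_asd_map_sum_asd (R : CurvOp) (j : Fin 3) (c : Fin 3 → ℝ) :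
    ad (asd j) (R.1 (∑ q, c q • asd q)) = (-2 : ℝ) • ∑ m, (c ᵥ* (blockD R * crossMatrix j)) m • asd m := by
  simp only [map_sum, map_smul, ad_asd_map_asd, smul_comm _ (-2 : ℝ), ← Finset.smul_sum, sum_smul_sum_smul]

/-- Bracketing with a self-dual bivector kills Λ⁻, so only A enters the trace. The constant is −½
from `sharpForm`, times (−2)² from the two brackets; the factor ½ in `trace_eq_sum_sd` cancels the
squared norm 2. -/
theorem inner_sharp_sd_sd (R : CurvOp) (i j : Fin 3) : inner ℝ (sharp R.1 (sd i)) (sd j) =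
    -2 * (blockA R * crossMatrix j * (blockA R * crossMatrix i)).trace := by
  rw [inner_sharp, sharpForm, LinearMap.mk₂_apply, trace_eq_sum_sd]
  simp only [LinearMap.comp_apply, ContinuousLinearMap.coe_coe, ad_sd_map_sd, ad_sd_map_asd, map_smul, ad_sd_map_sum_sd,
    real_inner_smul_left, sum_inner, inner_sd, inner_sd_asd_eq_zero, mul_zero, Finset.sum_const_zero, mul_ite,
    Finset.sum_ite_eq', Finset.mem_univ, if_true, add_zero, vecMul_eq_mul_apply]
  simp only [Matrix.trace, Matrix.diag_apply, Fin.sum_univ_three]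
  ring

theorem inner_sharp_sd_asd (R : CurvOp) (i j : Fin 3) : inner ℝ (sharp R.1 (sd i)) (asd j) =
    -2 * (blockB R * crossMatrix j * ((blockB R)ᵀ * crossMatrix i)).trace := by
  rw [inner_sharp, sharpForm, LinearMap.mk₂_apply, trace_eq_sum_sd]
  simp only [LinearMap.comp_apply, ContinuousLinearMap.coe_coe, ad_asd_map_sd, ad_asd_map_asd, map_smul, ad_sd_map_sum_asd,
    real_inner_smul_left, sum_inner, inner_sd, inner_sd_asd_eq_zero, mul_zero, Finset.sum_const_zero, mul_ite,
    Finset.sum_ite_eq', Finset.mem_univ, if_true, add_zero, vecMul_eq_mul_apply]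
  simp only [Matrix.trace, Matrix.diag_apply, Fin.sum_univ_three]
  ring

theorem inner_sharp_asd_asd (R : CurvOp) (i j : Fin 3) : inner ℝ (sharp R.1 (asd i)) (asd j) =
    -2 * (blockD R * crossMatrix j * (blockD R * crossMatrix i)).trace := by
  rw [inner_sharp, sharpForm, LinearMap.mk₂_apply, trace_eq_sum_sd]
  simp only [LinearMap.comp_apply, ContinuousLinearMap.coe_coe, ad_asd_map_sd, ad_asd_map_asd, map_smul, ad_asd_map_sum_asd,
    real_inner_smul_left, sum_inner, inner_asd, inner_asd_sd_eq_zero, mul_zero, Finset.sum_const_zero, mul_ite,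
    Finset.sum_ite_eq', Finset.mem_univ, if_true, zero_add, vecMul_eq_mul_apply]
  simp only [Matrix.trace, Matrix.diag_apply, Fin.sum_univ_three]
  ring

/-- Both sides are 2×2 minors of A: each `crossMatrix` selects a pair of indices with a sign. This
turns R^# into adjugates. -/
theorem trace_mul_crossMatrix (A : Matrix (Fin 3) (Fin 3) ℝ) (i j : Fin 3) :
    (A * crossMatrix j * (Aᵀ * crossMatrix i)).trace = -2 * A.adjugate j i := by
  rw [adjugate_fin_three]
  fin_cases i <;> fin_cases j <;>
    simp [crossMatrix, Matrix.trace_fin_three, Matrix.mul_apply, Fin.sum_univ_three] <;> ring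

theorem hasBlocks_Q {R : CurvOp} {A B D : Matrix (Fin 3) (Fin 3) ℝ} (h : HasBlocks R A B D) :
    HasBlocks (Q R) (A * A + B * Bᵀ + (2 : ℝ) • A.adjugate) (A * B + B * D + (2 : ℝ) • B.adjugateᵀ)
      (D * D + Bᵀ * B + (2 : ℝ) • D.adjugate) := by
  obtain ⟨rfl, rfl, rfl⟩ := h
  constructor
  · ext i j
    have h1 := trace_mul_crossMatrix (blockA R) j i
    rw [blockA_transpose, Matrix.trace_mul_comm] at h1
    simp only [blockA, of_apply, Q, _root_.add_apply, inner_add_left, blockA_comp_self,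
      inner_sharp_sd_sd, Matrix.add_apply, Matrix.smul_apply, smul_eq_mul] at h1 ⊢
    rw [h1]
    ring
  · ext i j
    have h1 := trace_mul_crossMatrix (blockB R) i j
    simp only [blockB, of_apply, Q, _root_.add_apply, inner_add_left, blockB_comp_self,
      inner_sharp_sd_asd, Matrix.add_apply, Matrix.smul_apply, smul_eq_mul, transpose_apply] at h1 ⊢
    rw [h1]
    ring
  · ext i j
    have h1 := trace_mul_crossMatrix (blockD R) j i
    rw [blockD_transpose, Matrix.trace_mul_comm] at h1
    simp only [blockD, of_apply, Q, _root_.add_apply, inner_add_left, blockD_comp_self,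
      inner_sharp_asd_asd, Matrix.add_apply, Matrix.smul_apply, smul_eq_mul] at h1 ⊢
    rw [h1]
    ring

/-! ### Linear structure, and operators with prescribed blocks -/

theorem HasBlocks.add {R S : CurvOp} {A B D A' B' D' : Matrix (Fin 3) (Fin 3) ℝ}
    (hR : HasBlocks R A B D) (hS : HasBlocks S A' B' D') :
    HasBlocks (R + S) (A + A') (B + B') (D + D') := by
  obtain ⟨rfl, rfl, rfl⟩ := hR
  obtain ⟨rfl, rfl, rfl⟩ := hS
  constructor <;> ext i j <;>
    simp [blockA, blockB, blockD, inner_add_left] <;> ring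

theorem HasBlocks.smul {R : CurvOp} {A B D : Matrix (Fin 3) (Fin 3) ℝ}
    (hR : HasBlocks R A B D) (c : ℝ) : HasBlocks (c • R) (c • A) (c • B) (c • D) := by
  obtain ⟨rfl, rfl, rfl⟩ := hR
  constructor <;> ext i j <;>
    simp [blockA, blockB, blockD, real_inner_smul_left] <;> ring

theorem hasBlocks_idOp : HasBlocks idOp 1 0 1 := by
  constructor <;> ext i j <;>
    simp [blockA, blockB, blockD, idOp, inner_sd, inner_sd_asd_eq_zero, inner_asd, one_apply,
      -inner_self_eq_norm_sq_to_K]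

theorem HasBlocks.trace_eq {R : CurvOp} {A B D : Matrix (Fin 3) (Fin 3) ℝ}
    (hR : HasBlocks R A B D) : D.trace = A.trace := by
  rw [← hR.blockA_eq, ← hR.blockD_eq, trace_blockD]

theorem HasBlocks.scal_eq {R : CurvOp} {A B D : Matrix (Fin 3) (Fin 3) ℝ}
    (hR : HasBlocks R A B D) : scal R = 4 * A.trace := by
  rw [← hR.blockA_eq, trace_blockA]
  ring

/-- The rank one endomorphism `X ↦ ⟨ω, X⟩ η`. -/
noncomputable def rankOne (ω η : Bivector) : Bivector →L[ℝ] Bivector :=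
  (innerSL ℝ ω).smulRight η

theorem rankOne_apply (ω η X : Bivector) : rankOne ω η X = (inner ℝ ω X : ℝ) • η := rfl

theorem coeff_eq_inner_sd {T : Bivector →L[ℝ] Bivector} (hT : IsSym T) :
    coeff T 0 5 - coeff T 1 4 + coeff T 2 3 =
      (1 / 4 : ℝ) * (∑ i, inner ℝ (T (sd i)) (sd i) - ∑ i, inner ℝ (T (asd i)) (asd i)) := by
  have key := hT.coeff
  simp [sd, asd, inner_add_left, inner_add_right, inner_sub_left, inner_sub_right, coeff_def,
    Fin.sum_univ_three]
  simp only [key 5 0, key 4 1, key 3 2]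
  ring

theorem exists_hasBlocks {A D : Matrix (Fin 3) (Fin 3) ℝ} (B : Matrix (Fin 3) (Fin 3) ℝ)
    (hA : Aᵀ = A) (hD : Dᵀ = D) (htr : D.trace = A.trace) : ∃ R, HasBlocks R A B D := by
  have hA' := fun i j => congrFun (congrFun hA i) j
  have hD' := fun i j => congrFun (congrFun hD i) j
  simp only [transpose_apply] at hA' hD'
  let T : Bivector →L[ℝ] Bivector := (1 / 2 : ℝ) • ∑ i, ∑ j, (A i j • rankOne (sd i) (sd j) +
    B i j • (rankOne (sd i) (asd j) + rankOne (asd j) (sd i)) + D i j • rankOne (asd i) (asd j))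
  have hT : ∀ X Y, inner ℝ (T X) Y = (1 / 2 : ℝ) * ∑ i, ∑ j, (A i j * (inner ℝ (sd i) X * inner ℝ (sd j) Y) +
      B i j * (inner ℝ (sd i) X * inner ℝ (asd j) Y + inner ℝ (asd j) X * inner ℝ (sd i) Y) +
      D i j * (inner ℝ (asd i) X * inner ℝ (asd j) Y)) := by
    intro X Y
    simp only [T, _root_.smul_apply, _root_.sum_apply, _root_.add_apply, rankOne_apply, sum_inner,
      inner_add_left, real_inner_smul_left]
  have hsym : IsSym T := by
    intro X Y
    rw [hT, ← real_inner_comm, hT]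
    simp only [Fin.sum_univ_three, hA' 1 0, hA' 2 0, hA' 2 1, hD' 1 0, hD' 2 0, hD' 2 1]
    ring
  have h1 : ∀ i j, inner ℝ (T (sd i)) (sd j) = 2 * A i j := by
    intro i j
    rw [hT]
    simp [inner_sd, inner_asd_sd_eq_zero, -inner_self_eq_norm_sq_to_K, Finset.sum_ite_eq']
    ring
  have h2 : ∀ i j, inner ℝ (T (sd i)) (asd j) = 2 * B i j := by
    intro i j
    rw [hT]
    simp [inner_sd, inner_asd, inner_asd_sd_eq_zero, inner_sd_asd_eq_zero, -inner_self_eq_norm_sq_to_K]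
    ring
  have h3 : ∀ i j, inner ℝ (T (asd i)) (asd j) = 2 * D i j := by
    intro i j
    rw [hT]
    simp [inner_asd, inner_sd_asd_eq_zero, -inner_self_eq_norm_sq_to_K]
    ring
  have hB : Bianchi T := by
    rw [bianchi_iff T hsym, coeff_eq_inner_sd hsym]
    simp only [h1, h3, ← Finset.mul_sum]
    simp only [Matrix.trace, diag_apply] at htr
    rw [htr]
    ring
  refine ⟨⟨T, hsym, hB⟩, ?_, ?_, ?_⟩ <;> ext i j
  · simp [blockA, h1]
  · simp [blockB, h2]
  · simp [blockD, h3]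

/-! ### The action of O(4) on the blocks -/

theorem inner_act_apply (g : Matrix (Fin 4) (Fin 4) ℝ) (R : CurvOp) (X Y : Bivector) :
    inner ℝ ((act g R).1 X) Y = inner ℝ (R.1 (conj g X)) (conj g Y) := by
  simp only [act, ContinuousLinearMap.comp_apply, inner_conj_transpose]

theorem conj_mul (g h : Matrix (Fin 4) (Fin 4) ℝ) (X : Bivector) :
    conj (g * h) X = conj g (conj h X) := by
  apply Bivector.ext
  simp [conj_mat, Matrix.mul_assoc]

theorem conj_smul (t : ℝ) (g : Matrix (Fin 4) (Fin 4) ℝ) (X : Bivector) :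
    conj (t • g) X = t ^ 2 • conj g X := by
  apply Bivector.ext
  simp [conj_mat, smul_smul, sq]

/-- The reflection in the first coordinate hyperplane. -/
def reflection : Matrix (Fin 4) (Fin 4) ℝ := diagonal ![-1, 1, 1, 1]

theorem sd_mat (i : Fin 3) : (sd i).mat = ![!![0, 1, 0, 0; -1, 0, 0, 0; 0, 0, 0, 1; 0, 0, -1, 0],
    !![0, 0, 1, 0; 0, 0, 0, -1; -1, 0, 0, 0; 0, 1, 0, 0],
    !![0, 0, 0, 1; 0, 0, 1, 0; 0, -1, 0, 0; -1, 0, 0, 0]] i := by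
  have h : ∀ M hM, sd i = ofMat M hM → (sd i).mat = M := fun M hM h => by rw [h, mat_ofMat]
  refine h _ ?_ ?_
  · fin_cases i <;> ext k l <;> fin_cases k <;> fin_cases l <;> simp
  · apply stdBasis.repr.injective
    ext l
    rw [repr_eq (ofMat _ _)]
    fin_cases i <;> fin_cases l <;> simp [sd, stdBasis_repr, -OrthonormalBasis.repr_self]

theorem asd_mat (i : Fin 3) : (asd i).mat = ![!![0, -1, 0, 0; 1, 0, 0, 0; 0, 0, 0, 1; 0, 0, -1, 0],
    !![0, 0, -1, 0; 0, 0, 0, -1; 1, 0, 0, 0; 0, 1, 0, 0],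
    !![0, 0, 0, -1; 0, 0, 1, 0; 0, -1, 0, 0; 1, 0, 0, 0]] i := by
  have h : ∀ M hM, asd i = ofMat M hM → (asd i).mat = M := fun M hM h => by rw [h, mat_ofMat]
  refine h _ ?_ ?_
  · fin_cases i <;> ext k l <;> fin_cases k <;> fin_cases l <;> simp
  · apply stdBasis.repr.injective
    ext l
    rw [repr_eq (ofMat _ _)]
    fin_cases i <;> fin_cases l <;> simp [asd, stdBasis_repr, -OrthonormalBasis.repr_self]

theorem conj_reflection_sd (i : Fin 3) : conj reflection (sd i) = asd i := by
  apply Bivector.ext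
  rw [conj_mat, sd_mat, asd_mat, reflection]
  fin_cases i <;> ext k l <;> fin_cases k <;> fin_cases l <;> simp [diagonal_mul, mul_diagonal]

theorem conj_reflection_asd (i : Fin 3) : conj reflection (asd i) = sd i := by
  apply Bivector.ext
  rw [conj_mat, sd_mat, asd_mat, reflection]
  fin_cases i <;> ext k l <;> fin_cases k <;> fin_cases l <;> simp [diagonal_mul, mul_diagonal]

/-- The matrix of left multiplication by the quaternion `a + b i + c j + d k`. -/
def leftMul (a b c d : ℝ) : Matrix (Fin 4) (Fin 4) ℝ :=
  !![a, -b, -c, -d; b, a, -d, c; c, d, a, -b; d, -c, b, a]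

/-- The matrix of conjugation by the quaternion `a + b i + c j + d k`, up to normalisation. -/
def rotMatrix (a b c d : ℝ) : Matrix (Fin 3) (Fin 3) ℝ :=
  !![a ^ 2 + b ^ 2 - c ^ 2 - d ^ 2, 2 * (b * c - a * d), 2 * (b * d + a * c);
    2 * (b * c + a * d), a ^ 2 - b ^ 2 + c ^ 2 - d ^ 2, 2 * (c * d - a * b);
    2 * (b * d - a * c), 2 * (c * d + a * b), a ^ 2 - b ^ 2 - c ^ 2 + d ^ 2]

/-- Up to sign, the matrices of `sd` are the left multiplications by the imaginary units and those
of `asd` the right ones. Conjugating by a left multiplication therefore rotates the former and only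
scales the latter. -/
theorem conj_leftMul_sd (a b c d : ℝ) (i : Fin 3) :
    conj (leftMul a b c d) (sd i) = ∑ j, rotMatrix a b c d j i • sd j := by
  rw [Fin.sum_univ_three]
  fin_cases i <;> apply ext_entries <;>
    simp only [conj_mat, mat_add, mat_smul, sd_mat, leftMul, rotMatrix] <;>
    simp [Matrix.mul_apply, Fin.sum_univ_four] <;> ring

theorem conj_leftMul_asd (a b c d : ℝ) (i : Fin 3) :
    conj (leftMul a b c d) (asd i) = (a ^ 2 + b ^ 2 + c ^ 2 + d ^ 2) • asd i := by
  fin_cases i <;> apply ext_entries <;>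
    simp only [conj_mat, mat_smul, asd_mat, leftMul] <;>
    simp [Matrix.mul_apply, Fin.sum_univ_four] <;> ring

/-- Rotation matrices that come from a quaternion. -/
def IsRot (U : Matrix (Fin 3) (Fin 3) ℝ) : Prop :=
  ∃ a b c d : ℝ, 0 < a ^ 2 + b ^ 2 + c ^ 2 + d ^ 2 ∧
    rotMatrix a b c d = (a ^ 2 + b ^ 2 + c ^ 2 + d ^ 2) • U

theorem leftMul_mul_transpose (a b c d : ℝ) :
    leftMul a b c d * (leftMul a b c d)ᵀ = (a ^ 2 + b ^ 2 + c ^ 2 + d ^ 2) • 1 := by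
  ext i j
  fin_cases i <;> fin_cases j <;>
    simp [leftMul, Matrix.mul_apply, Fin.sum_univ_four, one_apply] <;> ring

theorem det_leftMul (a b c d : ℝ) : (leftMul a b c d).det = (a ^ 2 + b ^ 2 + c ^ 2 + d ^ 2) ^ 2 := by
  simp [leftMul, det_succ_row_zero, Fin.sum_univ_succ, Fin.succAbove]
  ring

theorem IsRot.exists_specialOrthogonal {U : Matrix (Fin 3) (Fin 3) ℝ} (hU : IsRot U) :
    ∃ g ∈ specialOrthogonalGroup (Fin 4) ℝ, (∀ i, conj g (sd i) = ∑ j, U j i • sd j) ∧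
      ∀ i, conj g (asd i) = asd i := by
  obtain ⟨a, b, c, d, h0, h⟩ := hU
  set n := a ^ 2 + b ^ 2 + c ^ 2 + d ^ 2 with hn
  have hs : ((√n)⁻¹) ^ 2 = n⁻¹ := by rw [inv_pow, Real.sq_sqrt h0.le]
  have hs' : (√n)⁻¹ * (√n)⁻¹ = n⁻¹ := by rw [← sq, hs]
  refine ⟨(√n)⁻¹ • leftMul a b c d, ?_, fun i => ?_, fun i => ?_⟩
  · rw [mem_specialOrthogonalGroup_iff, mem_orthogonalGroup_iff]
    constructor
    · rw [transpose_smul,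
        smul_mul_smul_comm, leftMul_mul_transpose, smul_smul, hs', ← hn, inv_mul_cancel₀ h0.ne', one_smul]
    · rw [det_smul, det_leftMul, Fintype.card_fin, show ((√n)⁻¹) ^ 4 = (((√n)⁻¹) ^ 2) ^ 2 by ring, hs, ← hn,
        ← mul_pow, inv_mul_cancel₀ h0.ne', one_pow]
  · rw [conj_smul, hs, conj_leftMul_sd, h, Finset.smul_sum]
    simp [smul_smul, h0.ne']
  · rw [conj_smul, hs, conj_leftMul_asd, ← hn, smul_smul, inv_mul_cancel₀ h0.ne', one_smul]

theorem reflection_mul_self : reflection * reflection = 1 := by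
  rw [reflection, diagonal_mul_diagonal, ← diagonal_one]
  congr 1
  ext i
  fin_cases i <;> simp

theorem det_reflection : reflection.det = -1 := by
  simp [reflection, det_diagonal, Fin.prod_univ_four]

theorem reflection_mem_orthogonalGroup : reflection ∈ orthogonalGroup (Fin 4) ℝ := by
  rw [mem_orthogonalGroup_iff]
  conv_lhs => rw [reflection, diagonal_transpose, ← reflection]
  exact reflection_mul_self

/-- The reflection exchanges Λ⁺ and Λ⁻, so conjugating by it carries rotations of one factor to
rotations of the other, and the determinant is unchanged. -/
theorem IsRot.exists_specialOrthogonal' {U : Matrix (Fin 3) (Fin 3) ℝ} (hU : IsRot U) :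
    ∃ g ∈ specialOrthogonalGroup (Fin 4) ℝ, (∀ i, conj g (sd i) = sd i) ∧
      ∀ i, conj g (asd i) = ∑ j, U j i • asd j := by
  obtain ⟨g, hg, h1, h2⟩ := hU.exists_specialOrthogonal
  rw [mem_specialOrthogonalGroup_iff] at hg
  refine ⟨reflection * g * reflection, ?_, fun i => ?_, fun i => ?_⟩
  · rw [mem_specialOrthogonalGroup_iff]
    refine ⟨mul_mem (mul_mem reflection_mem_orthogonalGroup hg.1) reflection_mem_orthogonalGroup, ?_⟩
    rw [det_mul, det_mul, hg.2, det_reflection]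
    norm_num
  · rw [conj_mul, conj_mul, conj_reflection_sd, h2, conj_reflection_asd]
  · simp only [conj_mul, conj_reflection_asd, h1, map_sum, map_smul, conj_reflection_sd]

theorem HasBlocks.act_sd {R : CurvOp} {A B D : Matrix (Fin 3) (Fin 3) ℝ} (hR : HasBlocks R A B D)
    {g : Matrix (Fin 4) (Fin 4) ℝ} {U : Matrix (Fin 3) (Fin 3) ℝ}
    (h1 : ∀ i, conj g (sd i) = ∑ j, U j i • sd j) (h2 : ∀ i, conj g (asd i) = asd i) :
    HasBlocks (act g R) (Uᵀ * A * U) (Uᵀ * B) D := by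
  obtain ⟨rfl, rfl, rfl⟩ := hR
  constructor <;> ext i j <;>
    simp only [blockA, blockB, blockD, of_apply, inner_act_apply, h1, h2, map_add, map_smul, inner_add_left,
      inner_add_right, real_inner_smul_left, real_inner_smul_right, Matrix.mul_apply, transpose_apply,
      Fin.sum_univ_three] <;> ring

theorem HasBlocks.act_asd {R : CurvOp} {A B D : Matrix (Fin 3) (Fin 3) ℝ} (hR : HasBlocks R A B D)
    {g : Matrix (Fin 4) (Fin 4) ℝ} {U : Matrix (Fin 3) (Fin 3) ℝ}
    (h1 : ∀ i, conj g (sd i) = sd i) (h2 : ∀ i, conj g (asd i) = ∑ j, U j i • asd j) :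
    HasBlocks (act g R) A (B * U) (Uᵀ * D * U) := by
  obtain ⟨rfl, rfl, rfl⟩ := hR
  constructor <;> ext i j <;>
    simp only [blockA, blockB, blockD, of_apply, inner_act_apply, h1, h2, map_add, map_smul, inner_add_left,
      inner_add_right, real_inner_smul_left, real_inner_smul_right, Matrix.mul_apply, transpose_apply,
      Fin.sum_univ_three] <;> ring

theorem HasBlocks.act_reflection {R : CurvOp} {A B D : Matrix (Fin 3) (Fin 3) ℝ}
    (hR : HasBlocks R A B D) : HasBlocks (act reflection R) D Bᵀ A := by
  obtain ⟨rfl, rfl, rfl⟩ := hR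
  constructor <;> ext i j <;>
    simp only [blockA, blockB, blockD, of_apply, inner_act_apply, conj_reflection_sd,
      conj_reflection_asd, inner_asd_sd, transpose_apply]
  ring

theorem act_reflection_act_reflection (R : CurvOp) : act reflection (act reflection R) = R :=
  HasBlocks.ext (hasBlocks R).act_reflection.act_reflection (hasBlocks R)

theorem Q_act_reflection (R : CurvOp) : Q (act reflection R) = act reflection (Q R) := by
  have h1 := hasBlocks_Q (hasBlocks R).act_reflection
  have h2 := (hasBlocks_Q (hasBlocks R)).act_reflection
  rw [transpose_transpose] at h1
  rw [transpose_add, transpose_add, transpose_mul, transpose_mul, blockA_transpose, blockD_transpose,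
    add_comm ((blockB R)ᵀ * _), transpose_smul, transpose_transpose] at h2
  rw [← adjugate_transpose, transpose_transpose] at h1
  exact h1.ext h2

/-! ### Supporting functionals of curvature cones -/

namespace IsCurvatureCone

variable {G : Set (Matrix (Fin 4) (Fin 4) ℝ)} {C : Set CurvOp}

theorem add_mem (hC : IsCurvatureCone G C) {R S : CurvOp} (hR : R ∈ C) (hS : S ∈ C) : R + S ∈ C := by
  have h := hC.smul_mem 2 two_pos _ (hC.convex hR hS (a := 1 / 2) (b := 1 / 2) (by norm_num) (by norm_num)
    (by norm_num))
  rw [smul_add, smul_smul, smul_smul] at h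
  norm_num at h
  exact h

theorem idOp_mem (hC : IsCurvatureCone G C) : idOp ∈ C := interior_subset hC.id_mem_interior

theorem zero_mem (hC : IsCurvatureCone G C) : (0 : CurvOp) ∈ C := by
  have h : Filter.Tendsto (fun c : ℝ => c • idOp) (𝓝[>] 0) (𝓝 ((0 : ℝ) • idOp)) :=
    ((continuous_id.smul continuous_const).tendsto 0).mono_left nhdsWithin_le_nhds
  rw [zero_smul] at h
  exact hC.isClosed.mem_of_tendsto h
    (eventually_nhdsWithin_of_forall fun c hc => hC.smul_mem c hc _ hC.idOp_mem)

theorem smul_mem_of_nonneg (hC : IsCurvatureCone G C) {c : ℝ} (hc : 0 ≤ c) {R : CurvOp} (hR : R ∈ C) :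
    c • R ∈ C := by
  rcases hc.eq_or_lt with rfl | hc
  · rw [zero_smul]
    exact hC.zero_mem
  · exact hC.smul_mem c hc R hR

/-- A point of the interior can be moved in every direction. -/
theorem exists_add_smul_mem {S : CurvOp} (hS : S ∈ interior C) (V : CurvOp) :
    ∃ ε : ℝ, 0 < ε ∧ S + ε • V ∈ C := by
  have h : Filter.Tendsto (fun c : ℝ => S + c • V) (𝓝[>] 0) (𝓝 (S + (0 : ℝ) • V)) :=
    ((continuous_const.add (continuous_id.smul continuous_const)).tendsto 0).mono_left nhdsWithin_le_nhds
  rw [zero_smul, add_zero] at h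
  obtain ⟨ε, h1, h2⟩ := ((h.eventually (mem_interior_iff_mem_nhds.1 hS)).and self_mem_nhdsWithin).exists
  exact ⟨ε, h2, h1⟩

/-- Hahn–Banach separates R from the open interior. A linear functional bounded above on a cone is
nonpositive there, and it is strictly negative at the interior point Id, so it can be normalised by
its value at Id. -/
theorem exists_support (hC : IsCurvatureCone G C) {R : CurvOp} (hR : R ∉ interior C) :
    ∃ f : StrongDual ℝ CurvOp, (∀ S ∈ C, 0 ≤ f S) ∧ f idOp = 1 ∧ f R ≤ 0 := by
  obtain ⟨f, hf⟩ := geometric_hahn_banach_open_point hC.convex.interior isOpen_interior hR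
  have hle : ∀ S ∈ C, f S ≤ f R := by
    intro S hS
    have hcl : S ∈ closure (interior C) := by
      rw [hC.convex.closure_interior_eq_closure_of_nonempty_interior ⟨_, hC.id_mem_interior⟩]
      exact subset_closure hS
    exact closure_minimal (fun T hT => (hf T hT).le) (isClosed_le f.continuous continuous_const) hcl
  have hR0 : 0 ≤ f R := by simpa using hle 0 hC.zero_mem
  have hnonpos : ∀ S ∈ C, f S ≤ 0 := by
    intro S hS
    by_contra! hpos
    have h := hle _ (hC.smul_mem ((f R + 1) / f S) (by positivity) S hS)
    rw [map_smul, smul_eq_mul, div_mul_cancel₀ _ hpos.ne'] at h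
    linarith
  have hid : f idOp < 0 := by
    -- Moving from Id towards R strictly raises f and stays in C for a short while, where f is still
    -- nonpositive; hence f is negative at Id itself.
    obtain ⟨ε, hε, h⟩ := exists_add_smul_mem hC.id_mem_interior (R - idOp)
    have h1 := hnonpos _ h
    have h2 := hf _ hC.id_mem_interior
    simp only [map_add, map_smul, map_sub, smul_eq_mul] at h1
    nlinarith
  refine ⟨(f idOp)⁻¹ • f, fun S hS => ?_, ?_, ?_⟩
  · exact mul_nonneg_of_nonpos_of_nonpos (inv_nonpos.2 hid.le) (hnonpos S hS)
  · exact inv_mul_cancel₀ hid.ne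
  · exact mul_nonpos_of_nonpos_of_nonneg (inv_nonpos.2 hid.le) hR0

/-- The complement of C is open, so V + ε Id is still outside C; a functional that is ≤ 0 there is
at most −ε at V. -/
theorem exists_strict_support (hC : IsCurvatureCone G C) {V : CurvOp} (hV : V ∉ C) :
    ∃ f : StrongDual ℝ CurvOp, (∀ S ∈ C, 0 ≤ f S) ∧ f idOp = 1 ∧ f V < 0 := by
  have hV' : V ∈ interior Cᶜ := by rwa [hC.isClosed.isOpen_compl.interior_eq]
  obtain ⟨ε, hε, h⟩ := exists_add_smul_mem hV' idOp
  obtain ⟨f, h1, h2, h3⟩ := hC.exists_support (fun h' => h (interior_subset h'))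
  refine ⟨f, h1, h2, ?_⟩
  simp only [map_add, map_smul, h2, smul_eq_mul, mul_one] at h3
  linarith

/-- The point where a ray that starts at the identity leaves a curvature cone, with a supporting
functional at this point. -/
theorem exists_exit (hC : IsCurvatureCone G C) {V : CurvOp} (hV : V ∉ C) {t : ℝ} (ht : 0 ≤ t)
    (hmem : idOp + t • V ∈ C) : ∃ τ : ℝ, t ≤ τ ∧ 0 < τ ∧ idOp + τ • V ∈ C ∧
      ∃ f : StrongDual ℝ CurvOp, (∀ S ∈ C, 0 ≤ f S) ∧ f idOp = 1 ∧ τ * f V = -1 := by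
  obtain ⟨f, hf, hf1, hfV⟩ := hC.exists_strict_support hV
  let T : Set ℝ := {τ | idOp + τ • V ∈ C}
  have hbdd : BddAbove T := by
    refine ⟨1 / (-f V), fun τ hτ => ?_⟩
    have h := hf _ hτ
    simp only [map_add, map_smul, hf1, smul_eq_mul] at h
    rw [le_div_iff₀ (by linarith)]
    linarith
  have hclosed : IsClosed T :=
    hC.isClosed.preimage (continuous_const.add (continuous_id.smul continuous_const))
  have hle : t ≤ sSup T := le_csSup hbdd hmem
  have hτ : idOp + sSup T • V ∈ C := hclosed.csSup_mem ⟨t, hmem⟩ hbdd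
  have hint : idOp + sSup T • V ∉ interior C := by
    intro h
    obtain ⟨ε, hε, h'⟩ := exists_add_smul_mem h V
    rw [add_assoc, ← add_smul] at h'
    have := le_csSup hbdd (show sSup T + ε ∈ T from h')
    linarith
  -- At the last point of the ray the functional is both ≥ 0 (membership) and ≤ 0 (not interior), so
  -- it vanishes there.
  obtain ⟨g, hg, hg1, hg0⟩ := hC.exists_support hint
  have h0 := hg _ hτ
  simp only [map_add, map_smul, hg1, smul_eq_mul] at h0 hg0
  refine ⟨sSup T, hle, (ht.trans hle).lt_of_ne fun h => ?_, hτ, g, hg, hg1, by linarith⟩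
  rw [← h] at hg0
  linarith

end IsCurvatureCone

/-- S is a boundary point because f is negative at S − ε Id for every ε > 0. A functional that is
nonnegative on C and zero at S is nonnegative on the tangent cone at S, as limits of nonnegative
multiples of f(d) with S + d in C. -/
theorem IsRicciFlowInvariant.apply_Q_nonneg {C : Set CurvOp} (hQ : IsRicciFlowInvariant C)
    {f : StrongDual ℝ CurvOp} (hf : ∀ S ∈ C, 0 ≤ f S) (hf1 : f idOp = 1) {S : CurvOp} (hS : S ∈ C)
    (h0 : f S = 0) : 0 ≤ f (Q S) := by
  have hfr : S ∈ frontier C := by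
    refine ⟨subset_closure hS, fun hint => ?_⟩
    obtain ⟨ε, hε, h⟩ := IsCurvatureCone.exists_add_smul_mem hint (-idOp)
    have h' := hf _ h
    simp only [map_add, map_smul, map_neg, hf1, h0, smul_eq_mul] at h'
    linarith
  obtain ⟨α, l, hl, c, d, -, hd, hcd⟩ := exists_fun_of_mem_tangentConeAt (hQ S hfr)
  refine ge_of_tendsto ((f.continuous.tendsto _).comp hcd) (hd.mono fun n hn => ?_)
  have h' := hf _ hn
  rw [map_add, h0, zero_add] at h'
  have h'' : f (c n • d n) = (c n : ℝ) * f (d n) := by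
    rw [NNReal.smul_def, map_smul, smul_eq_mul]
  rw [Function.comp_apply, h'']
  exact mul_nonneg (c n).coe_nonneg h'

/-! ### Curvature cones in block form, rotations and averaging -/

/-- The set `C` contains the operator with blocks `A`, `B`, `D`. -/
def Mem (C : Set CurvOp) (A B D : Matrix (Fin 3) (Fin 3) ℝ) : Prop := ∃ R ∈ C, HasBlocks R A B D

theorem mem_blocks {C : Set CurvOp} {R : CurvOp} (hR : R ∈ C) : Mem C (blockA R) (blockB R) (blockD R) :=
  ⟨R, hR, hasBlocks R⟩

theorem Mem.mem {C : Set CurvOp} {R : CurvOp} {A B D : Matrix (Fin 3) (Fin 3) ℝ} (h : Mem C A B D)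
    (hR : HasBlocks R A B D) : R ∈ C := by
  obtain ⟨S, hS, hS'⟩ := h
  rwa [hR.ext hS']

theorem Mem.transpose_eq {C : Set CurvOp} {A B D : Matrix (Fin 3) (Fin 3) ℝ} (h : Mem C A B D) :
    Aᵀ = A := by
  obtain ⟨R, -, rfl, -, -⟩ := h
  exact blockA_transpose R

namespace IsOrientedCurvatureCone

variable {C : Set CurvOp} {A B D A' B' D' U : Matrix (Fin 3) (Fin 3) ℝ}

theorem mem_add (hC : IsOrientedCurvatureCone C) (h : Mem C A B D) (h' : Mem C A' B' D') :
    Mem C (A + A') (B + B') (D + D') := by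
  obtain ⟨R, hR, hR'⟩ := h
  obtain ⟨S, hS, hS'⟩ := h'
  exact ⟨R + S, hC.add_mem hR hS, hR'.add hS'⟩

theorem mem_smul (hC : IsOrientedCurvatureCone C) {c : ℝ} (hc : 0 ≤ c) (h : Mem C A B D) :
    Mem C (c • A) (c • B) (c • D) := by
  obtain ⟨R, hR, hR'⟩ := h
  exact ⟨c • R, hC.smul_mem_of_nonneg hc hR, hR'.smul c⟩

theorem mem_one (hC : IsOrientedCurvatureCone C) : Mem C 1 0 1 := ⟨idOp, hC.idOp_mem, hasBlocks_idOp⟩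

theorem mem_rot (hC : IsOrientedCurvatureCone C) (hU : IsRot U) (h : Mem C A B D) :
    Mem C (Uᵀ * A * U) (Uᵀ * B) D := by
  obtain ⟨R, hR, hR'⟩ := h
  obtain ⟨g, hg, h1, h2⟩ := hU.exists_specialOrthogonal
  exact ⟨act g R, hC.act_mem g hg R hR, hR'.act_sd h1 h2⟩

theorem mem_rot' (hC : IsOrientedCurvatureCone C) (hU : IsRot U) (h : Mem C A B D) :
    Mem C A (B * U) (Uᵀ * D * U) := by
  obtain ⟨R, hR, hR'⟩ := h
  obtain ⟨g, hg, h1, h2⟩ := hU.exists_specialOrthogonal'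
  exact ⟨act g R, hC.act_mem g hg R hR, hR'.act_asd h1 h2⟩

end IsOrientedCurvatureCone

theorem isRot_halfTurn₀ : IsRot !![1, 0, 0; 0, -1, 0; 0, 0, -1] := by
  refine ⟨0, 1, 0, 0, by norm_num, ?_⟩
  ext i j
  fin_cases i <;> fin_cases j <;> norm_num [rotMatrix]

theorem isRot_halfTurn₁ : IsRot !![-1, 0, 0; 0, 1, 0; 0, 0, -1] := by
  refine ⟨0, 0, 1, 0, by norm_num, ?_⟩
  ext i j
  fin_cases i <;> fin_cases j <;> norm_num [rotMatrix]

theorem isRot_halfTurn₂ : IsRot !![-1, 0, 0; 0, -1, 0; 0, 0, 1] := by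
  refine ⟨0, 0, 0, 1, by norm_num, ?_⟩
  ext i j
  fin_cases i <;> fin_cases j <;> norm_num [rotMatrix]

theorem isRot_quarterTurn : IsRot !![0, -1, 0; 1, 0, 0; 0, 0, 1] := by
  refine ⟨1, 0, 0, 1, by norm_num, ?_⟩
  ext i j
  fin_cases i <;> fin_cases j <;> norm_num [rotMatrix]

theorem isRot_cycle : IsRot !![0, 0, 1; 1, 0, 0; 0, 1, 0] := by
  refine ⟨1, 1, 1, 1, by norm_num, ?_⟩
  ext i j
  fin_cases i <;> fin_cases j <;> norm_num [rotMatrix]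

theorem isRot_cycle_inv : IsRot !![0, 1, 0; 0, 0, 1; 1, 0, 0] := by
  refine ⟨1, -1, -1, -1, by norm_num, ?_⟩
  ext i j
  fin_cases i <;> fin_cases j <;> norm_num [rotMatrix]

theorem IsRot.mul_transpose {U : Matrix (Fin 3) (Fin 3) ℝ} (hU : IsRot U) : U * Uᵀ = 1 := by
  obtain ⟨a, b, c, d, h0, h⟩ := hU
  have h1 : rotMatrix a b c d * (rotMatrix a b c d)ᵀ =
      ((a ^ 2 + b ^ 2 + c ^ 2 + d ^ 2) * (a ^ 2 + b ^ 2 + c ^ 2 + d ^ 2)) • 1 := by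
    ext i j
    fin_cases i <;> fin_cases j <;>
      simp [rotMatrix, Matrix.mul_apply, Fin.sum_univ_three] <;> ring
  rw [h, transpose_smul, smul_mul_smul_comm] at h1
  exact smul_right_injective _ (mul_pos h0 h0).ne' h1

/-- Every unit vector is, up to sign, the image of the last basis vector under a rotation. -/
theorem exists_isRot (x : Fin 3 → ℝ) (hx : x ⬝ᵥ x = 1) :
    ∃ U, IsRot U ∧ ∀ A : Matrix (Fin 3) (Fin 3) ℝ, (Uᵀ * A * U) 2 2 = x ⬝ᵥ A *ᵥ x := by
  -- The half-turn about x + e₂ sends e₂ to x, but its axis degenerates at x = −e₂. Quadratic forms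
  -- do not see the sign of x, so x may be taken in the upper half space.
  wlog h : 0 ≤ x 2 generalizing x
  · obtain ⟨U, hU, h'⟩ := this (-x) (by simpa using hx) (by simp; linarith)
    exact ⟨U, hU, fun A => by rw [h' A]; simp [mulVec_neg]⟩
  simp only [dotProduct, Fin.sum_univ_three] at hx
  have hn : 0 ^ 2 + x 0 ^ 2 + x 1 ^ 2 + (x 2 + 1) ^ 2 = 2 * (x 2 + 1) := by linear_combination hx
  have h0 : 0 < 2 * (x 2 + 1) := by positivity
  refine ⟨(2 * (x 2 + 1))⁻¹ • rotMatrix 0 (x 0) (x 1) (x 2 + 1),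
    ⟨0, x 0, x 1, x 2 + 1, by rwa [hn], by rw [hn, smul_smul, mul_inv_cancel₀ h0.ne', one_smul]⟩, ?_⟩
  have hcol : ∀ i, ((2 * (x 2 + 1))⁻¹ • rotMatrix 0 (x 0) (x 1) (x 2 + 1)) i 2 = x i := by
    intro i
    rw [Matrix.smul_apply, smul_eq_mul, inv_mul_eq_iff_eq_mul₀ h0.ne']
    fin_cases i <;> simp [rotMatrix]
    · ring
    · ring
    · linear_combination -hx
  intro A
  simp only [Matrix.mul_apply, transpose_apply, hcol, dotProduct, mulVec, Fin.sum_univ_three]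
  ring

namespace IsOrientedCurvatureCone

variable {C : Set CurvOp} {A B D : Matrix (Fin 3) (Fin 3) ℝ}

/-- This is the average over the tetrahedral rotation group of Λ⁻: the half-turns kill B and the
off-diagonal part of D, then the 3-cycles equalise the diagonal. -/
theorem mem_average_asd (hC : IsOrientedCurvatureCone C) (h : Mem C A B D) :
    Mem C A 0 ((D.trace / 3) • 1) := by
  have h1 := hC.mem_smul (c := 1 / 4) (by norm_num) (hC.mem_add (hC.mem_add (hC.mem_add h
    (hC.mem_rot' isRot_halfTurn₀ h)) (hC.mem_rot' isRot_halfTurn₁ h)) (hC.mem_rot' isRot_halfTurn₂ h))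
  have h2 := hC.mem_smul (c := 1 / 3) (by norm_num) (hC.mem_add (hC.mem_add h1
    (hC.mem_rot' isRot_cycle h1)) (hC.mem_rot' isRot_cycle_inv h1))
  convert h2 using 1
  · module
  · ext i j
    fin_cases i <;> fin_cases j <;> simp [Matrix.mul_apply, Fin.sum_univ_three]
  · ext i j
    fin_cases i <;> fin_cases j <;>
      simp [Matrix.mul_apply, Fin.sum_univ_three, Matrix.trace_fin_three] <;> ring

/-- This is the average over the four quarter-turns about the last axis: the half-turn decouples
that axis, the quarter-turn makes the remaining 2×2 block scalar. -/
theorem mem_average_sd (hC : IsOrientedCurvatureCone C) (h : Mem C A 0 D) :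
    Mem C (diagonal ![(A 0 0 + A 1 1) / 2, (A 0 0 + A 1 1) / 2, A 2 2]) 0 D := by
  have h1 := hC.mem_smul (c := 1 / 2) (by norm_num) (hC.mem_add h (hC.mem_rot isRot_halfTurn₂ h))
  have h2 := hC.mem_smul (c := 1 / 2) (by norm_num) (hC.mem_add h1 (hC.mem_rot isRot_quarterTurn h1))
  have hA : A 1 0 = A 0 1 := congrFun (congrFun h.transpose_eq 0) 1
  convert h2 using 1
  · ext i j
    fin_cases i <;> fin_cases j <;> simp [Matrix.mul_apply, Fin.sum_univ_three] <;> linarith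
  · simp
  · module

end IsOrientedCurvatureCone

/-! ### Weyl and traceless Ricci directions forced into the cone -/

/-- `C` contains the line spanned by the operator with blocks `A`, `B`, `D`. -/
def LineMem (C : Set CurvOp) (A B D : Matrix (Fin 3) (Fin 3) ℝ) : Prop :=
  ∀ c : ℝ, Mem C (c • A) (c • B) (c • D)

namespace IsOrientedCurvatureCone

variable {C : Set CurvOp} {A B D A' B' D' U : Matrix (Fin 3) (Fin 3) ℝ}

theorem lineMem (hC : IsOrientedCurvatureCone C) (h : Mem C A B D) (h' : Mem C (-A) (-B) (-D)) :
    LineMem C A B D := by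
  intro c
  rcases le_total 0 c with hc | hc
  · exact hC.mem_smul hc h
  · have h1 := hC.mem_smul (neg_nonneg.2 hc) h'
    simpa using h1

theorem lineMem_add (hC : IsOrientedCurvatureCone C) (h : LineMem C A B D) (h' : LineMem C A' B' D') :
    LineMem C (A + A') (B + B') (D + D') := by
  intro c
  simpa only [smul_add] using hC.mem_add (h c) (h' c)

theorem _root_.HalfPIC.LineMem.smul (h : LineMem C A B D) (c : ℝ) :
    LineMem C (c • A) (c • B) (c • D) := by
  intro t
  simpa only [smul_smul] using h (t * c)

theorem lineMem_rot (hC : IsOrientedCurvatureCone C) (hU : IsRot U) (h : LineMem C A B D) :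
    LineMem C (Uᵀ * A * U) (Uᵀ * B) D := by
  intro c
  simpa only [mul_smul_comm, smul_mul_assoc] using hC.mem_rot hU (h c)

theorem lineMem_rot' (hC : IsOrientedCurvatureCone C) (hU : IsRot U) (h : LineMem C A B D) :
    LineMem C A (B * U) (Uᵀ * D * U) := by
  intro c
  simpa only [mul_smul_comm, smul_mul_assoc] using hC.mem_rot' hU (h c)

theorem _root_.HalfPIC.LineMem.mem (h : LineMem C A B D) : Mem C A B D := by
  simpa using h 1

/-- A supporting functional vanishes on the lines contained in the cone. -/
theorem _root_.HalfPIC.LineMem.apply_eq_zero (h : LineMem C A B D) {R : CurvOp} (hR : HasBlocks R A B D)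
    {f : StrongDual ℝ CurvOp} (hf : ∀ S ∈ C, 0 ≤ f S) : f R = 0 := by
  have h1 := hf _ ((h 1).mem (hR.smul 1))
  have h2 := hf _ ((h (-1)).mem (hR.smul (-1)))
  simp only [map_smul, smul_eq_mul] at h1 h2
  linarith

/-- If `C` contains an operator that is negative on a self-dual isotropic plane, then it contains
the self-dual Weyl tensor of a symmetric space. -/
theorem mem_weyl (hC : IsOrientedCurvatureCone C) (hQ : IsRicciFlowInvariant C) (hs : C ⊆ scalCone)
    (h : Mem C A B D) {x : Fin 3 → ℝ} (hx : A.trace * (x ⬝ᵥ x) < x ⬝ᵥ A *ᵥ x) :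
    Mem C (diagonal ![-1, -1, 2]) 0 0 := by
  -- The bad unit direction n is rotated to the last axis before averaging. This gives z = ⟨An, n⟩
  -- and 2x = tr A − ⟨An, n⟩ < 0.
  obtain ⟨x, z, hxz, h1⟩ : ∃ x z : ℝ, x < 0 ∧
      Mem C (diagonal ![x, x, z]) 0 (((2 * x + z) / 3) • 1) := by
    have hx0 : 0 < x ⬝ᵥ x := by
      refine lt_of_le_of_ne (Finset.sum_nonneg fun i _ => mul_self_nonneg (x i)) fun h0 => ?_
      rw [dotProduct_self_eq_zero.1 h0.symm] at hx
      simp at hx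
    obtain ⟨U, hU, hU'⟩ := exists_isRot ((√(x ⬝ᵥ x))⁻¹ • x) (by
      rw [smul_dotProduct, dotProduct_smul, smul_smul, ← mul_inv, Real.mul_self_sqrt hx0.le, smul_eq_mul,
        inv_mul_cancel₀ hx0.ne'])
    have h1 := hC.mem_rot hU (hC.mem_average_asd h)
    rw [mul_zero] at h1
    have h2 := hC.mem_average_sd h1
    have htr : (Uᵀ * A * U).trace = A.trace := by
      rw [Matrix.trace_mul_comm, ← Matrix.mul_assoc, hU.mul_transpose, one_mul]
    have hD : D.trace = A.trace := by
      obtain ⟨R, -, hR⟩ := h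
      exact hR.trace_eq
    have h22 : A.trace < (Uᵀ * A * U) 2 2 := by
      rw [hU', smul_dotProduct, mulVec_smul, dotProduct_smul, smul_smul, ← mul_inv,
        Real.mul_self_sqrt hx0.le, smul_eq_mul, inv_mul_eq_div, lt_div_iff₀ hx0]
      exact hx
    rw [← htr, Matrix.trace_fin_three] at h22
    refine ⟨((Uᵀ * A * U) 0 0 + (Uᵀ * A * U) 1 1) / 2, (Uᵀ * A * U) 2 2, by linarith, ?_⟩
    convert h2 using 1
    rw [hD, ← htr, Matrix.trace_fin_three]
    congr 1
    ring
  have hs0 : 0 ≤ 2 * x + z := by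
    obtain ⟨R, hR, hR'⟩ := h1
    have h2 := hs hR
    rw [scalCone, Set.mem_ofPred_eq, hR'.scal_eq] at h2
    simp [Fin.sum_univ_three] at h2
    linarith
  obtain ⟨W, hW⟩ := exists_hasBlocks (A := diagonal ![-1, -1, 2]) (D := 0) 0 (diagonal_transpose _)
    transpose_zero (by simp [Fin.sum_univ_three]; norm_num)
  by_contra hWC
  replace hWC : W ∉ C := fun h' => hWC ⟨W, h', hW⟩
  -- With zero scalar curvature the averaged operator is −x > 0 times W.
  rcases hs0.eq_or_lt with h0 | h0
  · obtain ⟨R, hR, hR'⟩ := h1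
    apply hWC
    have h2 : W = (-x)⁻¹ • R := by
      refine hW.ext (S := (-x)⁻¹ • R) ?_
      convert hR'.smul (-x)⁻¹ using 1
      · ext i j
        have hz : z = -2 * x := by linarith
        have hx0 : x ≠ 0 := hxz.ne
        fin_cases i <;> fin_cases j <;> simp [hz] <;> field_simp
      · simp
      · simp [← h0]
    rw [h2]
    exact hC.smul_mem_of_nonneg (inv_nonneg.2 (by linarith)) hR
  · have hne : x * 2 + z ≠ 0 := by linarith
    -- Otherwise the averaged operator is scaled to have the trace of Id. Its coefficient along W
    -- exceeds 1 since x < 0, so the exit time τ satisfies τ > 1.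
    have h2 : idOp + (1 - 3 * x / (2 * x + z)) • W ∈ C := by
      obtain ⟨R, hR, hR'⟩ := h1
      have h3 : idOp + (1 - 3 * x / (2 * x + z)) • W = (3 / (2 * x + z)) • R := by
        refine (hasBlocks_idOp.add (hW.smul _)).ext ?_
        convert hR'.smul (3 / (2 * x + z)) using 1
        · ext i j
          fin_cases i <;> fin_cases j <;> simp <;> field_simp
          ring
        · simp
        · rw [smul_smul, smul_zero, add_zero, show 3 / (2 * x + z) * ((2 * x + z) / 3) = 1 by field_simp,
            one_smul]
      rw [h3]
      exact hC.smul_mem_of_nonneg (by positivity) hR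
    have h3 : 3 * x / (2 * x + z) < 0 := div_neg_of_neg_of_pos (by linarith) h0
    obtain ⟨τ, hτ, hτ0, hmem, f, hf, hf1, hfW⟩ := hC.exists_exit hWC (by linarith) h2
    have h4 : 0 ≤ f (Q (idOp + τ • W)) := hQ.apply_Q_nonneg hf hf1 hmem (by
      rw [map_add, map_smul, hf1, smul_eq_mul, hfW]
      norm_num)
    -- Relative to Id, the W-component τ becomes τ² under Q. As τ f(W) = −1, the value of f on the
    -- right is 3 − 3τ, which is negative.
    have h5 : Q (idOp + τ • W) = (3 : ℝ) • idOp + (3 * τ ^ 2) • W := by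
      refine (hasBlocks_Q (hasBlocks_idOp.add (hW.smul τ))).ext ?_
      convert (hasBlocks_idOp.smul 3).add (hW.smul (3 * τ ^ 2)) using 1
      · rw [adjugate_fin_three]
        ext i j
        fin_cases i <;> fin_cases j <;> simp [Matrix.mul_apply, Fin.sum_univ_three] <;> ring
      · simp
      · simp
        module
    rw [h5, map_add, map_smul, map_smul, hf1] at h4
    simp only [smul_eq_mul] at h4
    nlinarith

end IsOrientedCurvatureCone

theorem isRot_pythagorean : IsRot !![-16/25, 12/25, 3/5; 12/25, -9/25, 4/5; 3/5, 4/5, 0] := by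
  refine ⟨0, 3, 4, 5, by norm_num, ?_⟩
  ext i j
  fin_cases i <;> fin_cases j <;> norm_num [rotMatrix]

namespace IsOrientedCurvatureCone

variable {C : Set CurvOp} {A B D A' B' D' U : Matrix (Fin 3) (Fin 3) ℝ}

/-- The three cyclic rotations of diag(−1, −1, 2) add up to zero, so −W also lies in C. The
rotations of W span the traceless symmetric matrices; the proof exhibits explicit generators. -/
theorem lineMem_weyl (hC : IsOrientedCurvatureCone C) (h : Mem C (diagonal ![-1, -1, 2]) 0 0)
    (hA : Aᵀ = A) (htr : A.trace = 0) : LineMem C A 0 0 := by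
  have h1 : Mem C (diagonal ![-1, 2, -1]) 0 0 := by
    convert hC.mem_rot isRot_cycle h using 1
    · ext i j
      fin_cases i <;> fin_cases j <;> simp [Matrix.mul_apply, Fin.sum_univ_three]
    · simp
  have h0 : Mem C (diagonal ![2, -1, -1]) 0 0 := by
    convert hC.mem_rot isRot_cycle h1 using 1
    · ext i j
      fin_cases i <;> fin_cases j <;> simp [Matrix.mul_apply, Fin.sum_univ_three]
    · simp
  have l2 : LineMem C (diagonal ![-1, -1, 2]) 0 0 := by
    refine hC.lineMem h ?_
    convert hC.mem_add h0 h1 using 1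
    · ext i j
      fin_cases i <;> fin_cases j <;> simp <;> norm_num
    · simp
    · simp
  have rot : ∀ {U A}, IsRot U → LineMem C A 0 0 → LineMem C (Uᵀ * A * U) 0 0 := by
    intro U A hU hA
    simpa using hC.lineMem_rot hU hA
  have add : ∀ {A A'}, LineMem C A 0 0 → LineMem C A' 0 0 → LineMem C (A + A') 0 0 := by
    intro A A' hA hA'
    simpa using hC.lineMem_add hA hA'
  have smul : ∀ (c : ℝ) {A}, LineMem C A 0 0 → LineMem C (c • A) 0 0 := by
    intro c A hA
    simpa using hA.smul c
  have l1 := rot isRot_cycle l2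
  have l0 := rot isRot_cycle l1
  -- Conjugation takes diag(−1, −1, 2) to −1 + 3uuᵀ with u = (3/5, 4/5, 0). Its off-diagonal entry
  -- is 36/25, and its diagonal is 9/25 of the first generator plus 16/25 of the second.
  have o01 : LineMem C !![0, 1, 0; 1, 0, 0; 0, 0, 0] 0 0 := by
    convert smul (25 / 36) (add (add (rot isRot_pythagorean l2) (smul (-9 / 25) l0)) (smul (-16 / 25) l1))
      using 1
    ext i j
    fin_cases i <;> fin_cases j <;> simp [Matrix.mul_apply, Fin.sum_univ_three] <;> norm_num
  -- The rotation shifts indices cyclically: `o02` carries the entries (1, 2), and `o12` the entries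
  -- (0, 2).
  have o02 := rot isRot_cycle_inv o01
  have o12 := rot isRot_cycle_inv o02
  have hA' := fun i j => congrFun (congrFun hA i) j
  simp only [transpose_apply] at hA'
  rw [Matrix.trace_fin_three] at htr
  convert add (add (add (smul (A 0 0 / 3) l0) (smul (A 1 1 / 3) l1)) (smul (A 2 2 / 3) l2))
    (add (add (smul (A 0 1) o01) (smul (A 1 2) o02)) (smul (A 0 2) o12)) using 1
  ext i j
  fin_cases i <;> fin_cases j <;>
    simp [Matrix.mul_apply, Fin.sum_univ_three, hA' 1 0, hA' 2 0, hA' 2 1] <;> linarith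

/-- At the exit point Id + τV the value of Q gives no contradiction. But f vanishes on the lines in
C, so the point may be sheared by tW while f stays 0: the trace of Q's A-block remains 9 + τ²,
whereas the coefficient of V grows to 2(1 + t)τ. -/
theorem mem_ricci (hC : IsOrientedCurvatureCone C) (hQ : IsRicciFlowInvariant C)
    (hA : ∀ A, Aᵀ = A → A.trace = 0 → LineMem C A 0 0)
    (hD : ∀ D, Dᵀ = D → D.trace = 0 → LineMem C 0 0 D) {ε : ℝ} (hε : ε ^ 2 = 1) :
    Mem C 0 (ε • single 0 0 1) 0 := by
  obtain ⟨V, hV⟩ := exists_hasBlocks (A := 0) (D := 0) (ε • single 0 0 (1 : ℝ)) transpose_zero transpose_zero rfl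
  obtain ⟨W, hW⟩ := exists_hasBlocks (A := diagonal ![2, -1, -1]) (D := 0) 0 (diagonal_transpose _)
    transpose_zero (by simp [Fin.sum_univ_three]; norm_num)
  have hWline := hA (diagonal ![2, -1, -1]) (diagonal_transpose _) (by simp [Fin.sum_univ_three]; norm_num)
  by_contra hVC
  replace hVC : V ∉ C := fun h' => hVC ⟨V, h', hV⟩
  obtain ⟨τ, -, hτ0, hmem, f, hf, hf1, hfV⟩ := hC.exists_exit hVC le_rfl (by
    rw [zero_smul, add_zero]
    exact hC.idOp_mem)
  -- This is the coefficient of Id in Q modulo traceless blocks. Taking the shear equal to it gives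
  -- f(Q) = t − 2(1 + t) = −2 − t < 0.
  set t : ℝ := (9 + τ ^ 2) / 3 with ht
  have hfW := hWline.apply_eq_zero hW hf
  have hSmem : idOp + τ • V + t • W ∈ C := by
    refine hC.add_mem hmem ((hWline t).mem ?_)
    simpa using hW.smul t
  have h4 : 0 ≤ f (Q (idOp + τ • V + t • W)) := hQ.apply_Q_nonneg hf hf1 hSmem (by
    rw [map_add, map_add, map_smul, map_smul, hf1, smul_eq_mul, hfV, hfW]
    norm_num)
  have hQS := hasBlocks_Q ((hasBlocks_idOp.add (hV.smul τ)).add (hW.smul t))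
  -- The remainder has no mixed block and traceless A and D, hence lies on the lines of C and is
  -- killed by f.
  set Z : CurvOp := Q (idOp + τ • V + t • W) + (-t) • idOp + (-(2 * (1 + t) * τ)) • V with hZ
  have hZblocks := (hQS.add (hasBlocks_idOp.smul (-t))).add (hV.smul (-(2 * (1 + t) * τ)))
  rw [← hZ] at hZblocks
  have hZB : blockB Z = 0 := by
    rw [hZblocks.blockB_eq, adjugate_fin_three]
    ext i j
    fin_cases i <;> fin_cases j <;> simp [Matrix.mul_apply, Fin.sum_univ_three]
    ring
  have hZtr : (blockA Z).trace = 0 := by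
    rw [hZblocks.blockA_eq, adjugate_fin_three, Matrix.trace_fin_three]
    simp [Matrix.mul_apply, Fin.sum_univ_three]
    rw [ht]
    linear_combination τ ^ 2 * hε
  have hZline : LineMem C (blockA Z) (blockB Z) (blockD Z) := by
    rw [hZB]
    simpa using hC.lineMem_add (hA (blockA Z) (blockA_transpose Z) hZtr)
      (hD (blockD Z) (blockD_transpose Z) (by rw [trace_blockD, hZtr]))
  have hfZ := hZline.apply_eq_zero (hasBlocks Z) hf
  rw [hZ] at hfZ
  simp only [map_add, map_smul, hf1, smul_eq_mul] at hfZ h4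
  have h5 : (2 * (1 + t) * τ) * f V = -(2 * (1 + t)) := by linear_combination 2 * (1 + t) * hfV
  have ht0 : 0 < t := by positivity
  linarith

/-- Independent cyclic rotations on both sides move the entry (0, 0) of B anywhere, so all mixed
blocks join the lines of C. Every operator is then a multiple of Id, nonnegative when the scalar
curvature is, plus an element of those lines. -/
theorem scalCone_subset (hC : IsOrientedCurvatureCone C) (hQ : IsRicciFlowInvariant C)
    (hA : ∀ A, Aᵀ = A → A.trace = 0 → LineMem C A 0 0)
    (hD : ∀ D, Dᵀ = D → D.trace = 0 → LineMem C 0 0 D) : scalCone ⊆ C := by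
  have e00 : LineMem C 0 (single 0 0 1) 0 := by
    refine hC.lineMem ?_ ?_
    · simpa using hC.mem_ricci hQ hA hD (ε := 1) (by norm_num)
    · simpa using hC.mem_ricci hQ hA hD (ε := -1) (by norm_num)
  have add : ∀ {B B'}, LineMem C 0 B 0 → LineMem C 0 B' 0 → LineMem C 0 (B + B') 0 := by
    intro B B' hB hB'
    simpa using hC.lineMem_add hB hB'
  have smul : ∀ (c : ℝ) {B}, LineMem C 0 B 0 → LineMem C 0 (c • B) 0 := by
    intro c B hB
    simpa using hB.smul c
  have row : ∀ {B}, LineMem C 0 B 0 → LineMem C 0 (!![0, 1, 0; 0, 0, 1; 1, 0, 0]ᵀ * B) 0 := by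
    intro B hB
    simpa using hC.lineMem_rot isRot_cycle_inv hB
  have col : ∀ {B}, LineMem C 0 B 0 → LineMem C 0 (B * !![0, 1, 0; 0, 0, 1; 1, 0, 0]) 0 := by
    intro B hB
    simpa using hC.lineMem_rot' isRot_cycle_inv hB
  have hrow : ∀ B : Matrix (Fin 3) (Fin 3) ℝ, LineMem C 0 (single 0 0 (B 0 0) + single 0 1 (B 0 1) +
      single 0 2 (B 0 2)) 0 := by
    intro B
    convert add (add (smul (B 0 0) e00) (smul (B 0 1) (col e00))) (smul (B 0 2) (col (col e00))) using 1
    ext i j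
    fin_cases i <;> fin_cases j <;> simp [Matrix.mul_apply, Fin.sum_univ_three]
  have hB : ∀ B, LineMem C 0 B 0 := by
    intro B
    -- `hrow` builds only a top row: rows 1 and 2 of B are swapped to the top, built there, and
    -- shifted back down by `row`.
    convert add (add (hrow B) (row (hrow (B.submatrix (Equiv.swap 0 1) id))))
      (row (row (hrow (B.submatrix (Equiv.swap 0 2) id)))) using 1
    ext i j
    fin_cases i <;> fin_cases j <;> simp [Matrix.mul_apply, Fin.sum_univ_three]
  intro R hR
  have htr : 0 ≤ (blockA R).trace := by
    rw [trace_blockA]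
    exact mul_nonneg (by norm_num) hR
  have h1 : Mem C (((blockA R).trace / 3) • 1) 0 (((blockA R).trace / 3) • 1) := by
    simpa using hC.mem_smul (div_nonneg htr (by norm_num : (0 : ℝ) ≤ 3)) hC.mem_one
  have h2 := hA (blockA R - ((blockA R).trace / 3) • 1)
    (by rw [transpose_sub, blockA_transpose, transpose_smul, transpose_one])
    (by rw [trace_sub, trace_smul, trace_one]; simp)
  have h3 := hD (blockD R - ((blockA R).trace / 3) • 1)
    (by rw [transpose_sub, blockD_transpose, transpose_smul, transpose_one])
    (by rw [trace_sub, trace_smul, trace_one, trace_blockD]; simp)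
  have h4 := hC.mem_add (hC.mem_add h1 (hB (blockB R)).mem) (hC.mem_add h2.mem h3.mem)
  refine h4.mem ?_
  convert hasBlocks R using 1
  · abel
  · simp
  · abel

end IsOrientedCurvatureCone

/-! ### Reversal of orientation -/

theorem act_add (g : Matrix (Fin 4) (Fin 4) ℝ) (R S : CurvOp) : act g (R + S) = act g R + act g S := by
  apply Subtype.ext
  ext X : 1
  simp [act]

theorem act_smul (g : Matrix (Fin 4) (Fin 4) ℝ) (c : ℝ) (R : CurvOp) : act g (c • R) = c • act g R := by
  apply Subtype.ext
  ext X : 1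
  simp [act]

theorem act_act (g h : Matrix (Fin 4) (Fin 4) ℝ) (R : CurvOp) : act h (act g R) = act (g * h) R := by
  apply Subtype.ext
  ext X : 1
  simp [act, conj_mul]

theorem continuous_act (g : Matrix (Fin 4) (Fin 4) ℝ) : Continuous (act g) :=
  Continuous.subtype_mk (continuous_const.clm_comp (continuous_subtype_val.clm_comp continuous_const)) _

/-- The action of the reflection on curvature operators. -/
noncomputable def actReflection : CurvOp ≃ₜ CurvOp where
  toFun := act reflection
  invFun := act reflection
  left_inv := act_reflection_act_reflection
  right_inv := act_reflection_act_reflection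
  continuous_toFun := continuous_act reflection
  continuous_invFun := continuous_act reflection

theorem act_reflection_idOp : act reflection idOp = idOp := by
  refine (hasBlocks_idOp.act_reflection).ext ?_
  simpa using hasBlocks_idOp

/-- The reflection normalises SO(4), acts by a linear homeomorphism and fixes Id. Every statement
about Λ⁺ thus transfers to Λ⁻. -/
theorem IsOrientedCurvatureCone.preimage_reflection {C : Set CurvOp} (hC : IsOrientedCurvatureCone C) :
    IsOrientedCurvatureCone (act reflection ⁻¹' C) where
  isClosed := hC.isClosed.preimage (continuous_act _)
  convex := by
    intro R hR S hS a b ha hb hab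
    rw [Set.mem_preimage, act_add, act_smul, act_smul]
    exact hC.convex hR hS ha hb hab
  smul_mem := by
    intro c hc R hR
    rw [Set.mem_preimage, act_smul]
    exact hC.smul_mem c hc _ hR
  act_mem := by
    intro g hg R hR
    have hg' : reflection * g * reflection ∈ specialOrthogonalGroup (Fin 4) ℝ := by
      replace hg : g ∈ specialOrthogonalGroup (Fin 4) ℝ := hg
      rw [mem_specialOrthogonalGroup_iff] at hg ⊢
      refine ⟨mul_mem (mul_mem reflection_mem_orthogonalGroup hg.1) reflection_mem_orthogonalGroup, ?_⟩
      rw [det_mul, det_mul, hg.2, det_reflection]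
      norm_num
    have h := hC.act_mem _ hg' _ hR
    rwa [act_act, ← Matrix.mul_assoc, ← Matrix.mul_assoc, reflection_mul_self, one_mul, ← act_act] at h
  id_mem_interior := by
    have h : act reflection ⁻¹' interior C = interior (act reflection ⁻¹' C) :=
      actReflection.preimage_interior C
    rw [← h, Set.mem_preimage, act_reflection_idOp]
    exact hC.id_mem_interior

theorem IsRicciFlowInvariant.preimage_reflection {C : Set CurvOp} (hC : IsRicciFlowInvariant C) :
    IsRicciFlowInvariant (act reflection ⁻¹' C) := by
  intro R hR
  have h : act reflection ⁻¹' frontier C = frontier (act reflection ⁻¹' C) :=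
    actReflection.preimage_frontier C
  rw [← h] at hR
  have h1 := hC _ hR
  rw [Q_act_reflection] at h1
  obtain ⟨α, l, hl, c, d, hd0, hd, hcd⟩ := exists_fun_of_mem_tangentConeAt h1
  have h0 : act reflection 0 = 0 := by simpa using act_smul reflection 0 0
  refine mem_tangentConeAt_of_seq l c (fun n => act reflection (d n)) ?_ ?_ ?_
  · have := ((continuous_act reflection).tendsto 0).comp hd0
    rwa [h0] at this
  · filter_upwards [hd] with n hn
    rwa [Set.mem_preimage, act_add, act_reflection_act_reflection]
  · have := ((continuous_act reflection).tendsto _).comp hcd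
    rw [act_reflection_act_reflection] at this
    refine this.congr fun n => ?_
    simp only [Function.comp_apply, NNReal.smul_def, act_smul]

theorem scal_act_reflection (R : CurvOp) : scal (act reflection R) = scal R := by
  rw [(hasBlocks R).act_reflection.scal_eq, (hasBlocks R).scal_eq, trace_blockD]

/-! ### Isotropic planes, duality and the action of O(4) -/

/-- Pairing ⋆(v ∧ w) with x ∧ y gives det(v, w, x, y) up to normalisation, and this determinant
scales by det g. For orthogonal g it says that g preserves or exchanges the two dualities according
to its determinant. -/
theorem hodgeStar_conj (g : Matrix (Fin 4) (Fin 4) ℂ) (v w : Fin 4 → ℂ) :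
    gᵀ * hodgeStar (wedgeMatrix (g *ᵥ v) (g *ᵥ w)) * g = g.det • hodgeStar (wedgeMatrix v w) := by
  ext i j
  have hdet : g.det = g 0 0 * (g 1 1 * (g 2 2 * g 3 3 - g 2 3 * g 3 2) - g 1 2 * (g 2 1 * g 3 3 - g 2 3 * g 3 1) + g 1 3 * (g 2 1 * g 3 2 - g 2 2 * g 3 1))
      - g 0 1 * (g 1 0 * (g 2 2 * g 3 3 - g 2 3 * g 3 2) - g 1 2 * (g 2 0 * g 3 3 - g 2 3 * g 3 0) + g 1 3 * (g 2 0 * g 3 2 - g 2 2 * g 3 0))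
      + g 0 2 * (g 1 0 * (g 2 1 * g 3 3 - g 2 3 * g 3 1) - g 1 1 * (g 2 0 * g 3 3 - g 2 3 * g 3 0) + g 1 3 * (g 2 0 * g 3 1 - g 2 1 * g 3 0))
      - g 0 3 * (g 1 0 * (g 2 1 * g 3 2 - g 2 2 * g 3 1) - g 1 1 * (g 2 0 * g 3 2 - g 2 2 * g 3 0) + g 1 2 * (g 2 0 * g 3 1 - g 2 1 * g 3 0)) := by
    simp [det_succ_row_zero, Fin.sum_univ_succ, Fin.succAbove]
    ring
  rw [Matrix.smul_apply, hdet]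
  fin_cases i <;> fin_cases j <;>
    simp [hodgeStar, wedgeMatrix, Matrix.mul_apply, Fin.sum_univ_four, vecMulVec_apply, mulVec, dotProduct] <;>
    ring

/-- The complexification of a real matrix. -/
def complexify (g : Matrix (Fin 4) (Fin 4) ℝ) : Matrix (Fin 4) (Fin 4) ℂ := g.map Complex.ofReal

theorem complexify_transpose_mul {g : Matrix (Fin 4) (Fin 4) ℝ} (hg : g ∈ orthogonalGroup (Fin 4) ℝ) :
    (complexify g)ᵀ * complexify g = 1 := by
  have h : gᵀ * g = 1 := (mem_orthogonalGroup_iff' _ _).1 hg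
  have h' := congrArg (fun M => M.map Complex.ofRealHom) h
  simp only [Matrix.map_mul] at h'
  change gᵀ.map Complex.ofRealHom * g.map Complex.ofRealHom = 1
  rw [h']
  simp

theorem complexify_mul_transpose {g : Matrix (Fin 4) (Fin 4) ℝ} (hg : g ∈ orthogonalGroup (Fin 4) ℝ) :
    complexify g * (complexify g)ᵀ = 1 :=
  mul_eq_one_comm.1 (complexify_transpose_mul hg)

theorem det_complexify (g : Matrix (Fin 4) (Fin 4) ℝ) : (complexify g).det = (g.det : ℂ) :=
  (RingHom.map_det Complex.ofRealHom g).symm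

theorem wedgeMatrix_mulVec (g : Matrix (Fin 4) (Fin 4) ℂ) (v w : Fin 4 → ℂ) :
    wedgeMatrix (g *ᵥ v) (g *ᵥ w) = g * wedgeMatrix v w * gᵀ := by
  simp only [wedgeMatrix, Matrix.mul_sub, Matrix.sub_mul,
    Matrix.mul_vecMulVec, Matrix.vecMulVec_mul, Matrix.vecMul_transpose]

theorem hodgeStar_orthogonal {g : Matrix (Fin 4) (Fin 4) ℝ} (hg : g ∈ orthogonalGroup (Fin 4) ℝ)
    (v w : Fin 4 → ℂ) : hodgeStar (complexWedge (complexify g *ᵥ v) (complexify g *ᵥ w)).1 =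
      (g.det : ℂ) • (complexify g * hodgeStar (complexWedge v w).1 * (complexify g)ᵀ) := by
  have h := hodgeStar_conj (complexify g) v w
  rw [det_complexify] at h
  have h' := congrArg (fun M => complexify g * M * (complexify g)ᵀ) h
  simp only [mul_smul_comm, smul_mul_assoc] at h'
  rw [← Matrix.mul_assoc, ← Matrix.mul_assoc, complexify_mul_transpose hg, one_mul, Matrix.mul_assoc,
    complexify_mul_transpose hg, mul_one] at h'
  exact h'

theorem spanIsotropicPlane_mulVec {g : Matrix (Fin 4) (Fin 4) ℝ} (hg : g ∈ orthogonalGroup (Fin 4) ℝ)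
    {v w : Fin 4 → ℂ} (h : SpanIsotropicPlane v w) :
    SpanIsotropicPlane (complexify g *ᵥ v) (complexify g *ᵥ w) := by
  obtain ⟨h0, h1, h2, h3⟩ := h
  have hd : ∀ x y : Fin 4 → ℂ, (complexify g *ᵥ x) ⬝ᵥ (complexify g *ᵥ y) = x ⬝ᵥ y := by
    intro x y
    rw [dotProduct_mulVec, ← mulVec_transpose, mulVec_mulVec, complexify_transpose_mul hg, one_mulVec]
  refine ⟨?_, by rw [hd, h1], by rw [hd, h2], by rw [hd, h3]⟩
  have hinj : Function.Injective (complexify g).mulVecLin := by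
    refine Function.LeftInverse.injective (g := (complexify g)ᵀ.mulVecLin) fun x => ?_
    simp only [mulVecLin_apply, mulVec_mulVec, complexify_transpose_mul hg, one_mulVec]
  have h4 := h0.map' (complexify g).mulVecLin (LinearMap.ker_eq_bot.2 hinj)
  have h5 : (complexify g).mulVecLin ∘ ![v, w] = ![complexify g *ᵥ v, complexify g *ᵥ w] := by
    ext i j
    fin_cases i <;> simp
  rwa [h5] at h4

theorem rePart_mulVec (g : Matrix (Fin 4) (Fin 4) ℝ) (v w : Fin 4 → ℂ) :
    rePart (complexWedge (complexify g *ᵥ v) (complexify g *ᵥ w)) = conj g (rePart (complexWedge v w)) := by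
  apply Bivector.ext
  rw [conj_mat]
  ext i j
  simp only [rePart, mat_ofMat, complexWedge, wedgeMatrix_mulVec, map_apply, Matrix.mul_apply,
    transpose_apply, complexify, Complex.re_sum, Complex.re_mul_ofReal, Complex.re_ofReal_mul]

theorem imPart_mulVec (g : Matrix (Fin 4) (Fin 4) ℝ) (v w : Fin 4 → ℂ) :
    imPart (complexWedge (complexify g *ᵥ v) (complexify g *ᵥ w)) = conj g (imPart (complexWedge v w)) := by
  apply Bivector.ext
  rw [conj_mat]
  ext i j
  simp only [imPart, mat_ofMat, complexWedge, wedgeMatrix_mulVec, map_apply, Matrix.mul_apply,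
    transpose_apply, complexify, Complex.im_sum, Complex.im_mul_ofReal, Complex.im_ofReal_mul]

theorem hermitian_act (g : Matrix (Fin 4) (Fin 4) ℝ) (R : CurvOp) (v w : Fin 4 → ℂ) :
    hermitian (complexExtension (act g R).1 (complexWedge v w)) (complexWedge v w) =
      hermitian (complexExtension R.1 (complexWedge (complexify g *ᵥ v) (complexify g *ᵥ w)))
        (complexWedge (complexify g *ᵥ v) (complexify g *ᵥ w)) := by
  rw [hermitian_complexExtension, hermitian_complexExtension, inner_act_apply, inner_act_apply,
    rePart_mulVec, imPart_mulVec]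

theorem isSelfDual_mulVec {g : Matrix (Fin 4) (Fin 4) ℝ} (hg : g ∈ orthogonalGroup (Fin 4) ℝ)
    (hdet : g.det = 1) {v w : Fin 4 → ℂ} (h : IsSelfDual (complexWedge v w)) :
    IsSelfDual (complexWedge (complexify g *ᵥ v) (complexify g *ᵥ w)) := by
  rw [IsSelfDual, hodgeStar_orthogonal hg, h, hdet, Complex.ofReal_one, one_smul]
  exact (wedgeMatrix_mulVec _ _ _).symm

theorem isAntiSelfDual_mulVec {g : Matrix (Fin 4) (Fin 4) ℝ} (hg : g ∈ orthogonalGroup (Fin 4) ℝ)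
    (hdet : g.det = -1) {v w : Fin 4 → ℂ} (h : IsSelfDual (complexWedge v w)) :
    IsAntiSelfDual (complexWedge (complexify g *ᵥ v) (complexify g *ᵥ w)) := by
  rw [IsAntiSelfDual, hodgeStar_orthogonal hg, h, hdet, Complex.ofReal_neg, Complex.ofReal_one, neg_smul,
    one_smul]
  exact congrArg _ (wedgeMatrix_mulVec _ _ _).symm

theorem isSelfDual_mulVec_of_isAntiSelfDual {g : Matrix (Fin 4) (Fin 4) ℝ}
    (hg : g ∈ orthogonalGroup (Fin 4) ℝ)
    (hdet : g.det = -1) {v w : Fin 4 → ℂ} (h : IsAntiSelfDual (complexWedge v w)) :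
    IsSelfDual (complexWedge (complexify g *ᵥ v) (complexify g *ᵥ w)) := by
  rw [IsSelfDual, hodgeStar_orthogonal hg, h, hdet, Complex.ofReal_neg, Complex.ofReal_one, neg_smul,
    one_smul, Matrix.mul_neg, Matrix.neg_mul, neg_neg]
  exact (wedgeMatrix_mulVec _ _ _).symm

theorem act_mem_nnicPlus {g : Matrix (Fin 4) (Fin 4) ℝ} (hg : g ∈ specialOrthogonalGroup (Fin 4) ℝ)
    {R : CurvOp} (hR : R ∈ nnicPlus) : act g R ∈ nnicPlus := by
  rw [mem_specialOrthogonalGroup_iff] at hg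
  intro v w h hsd
  rw [hermitian_act]
  exact hR _ _ (spanIsotropicPlane_mulVec hg.1 h) (isSelfDual_mulVec hg.1 hg.2 hsd)

theorem nnicMinus_eq_preimage : nnicMinus = act reflection ⁻¹' nnicPlus := by
  ext R
  constructor
  · intro hR v w h hsd
    rw [hermitian_act]
    exact hR _ _ (spanIsotropicPlane_mulVec reflection_mem_orthogonalGroup h)
      (isAntiSelfDual_mulVec reflection_mem_orthogonalGroup det_reflection hsd)
  · intro hR v w h hsd
    rw [← act_reflection_act_reflection R, hermitian_act]
    exact hR _ _ (spanIsotropicPlane_mulVec reflection_mem_orthogonalGroup h)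
      (isSelfDual_mulVec_of_isAntiSelfDual reflection_mem_orthogonalGroup det_reflection hsd)

theorem wedgeMatrix_mul_self {v w : Fin 4 → ℂ} (h : SpanIsotropicPlane v w) :
    wedgeMatrix v w * wedgeMatrix v w = 0 := by
  obtain ⟨-, h1, h2, h3⟩ := h
  simp [wedgeMatrix, Matrix.mul_sub, Matrix.sub_mul, vecMulVec_mul_vecMulVec, h1, h2, h3, dotProduct_comm w v]

/-- Isotropy makes the matrix Z of v ∧ w square to zero. The nine products of a coordinate of Z⁺
with one of Z⁻ are linear combinations of entries of Z², so they all vanish and one of the two parts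
is zero. -/
theorem isSelfDual_or_isAntiSelfDual {v w : Fin 4 → ℂ} (h : SpanIsotropicPlane v w) :
    IsSelfDual (complexWedge v w) ∨ IsAntiSelfDual (complexWedge v w) := by
  have hsq := wedgeMatrix_mul_self h
  set Z := complexWedge v w with hZ
  change Z.1 * Z.1 = 0 at hsq
  have hs := complexBivector_apply Z
  have h0 : ∀ i, Z.1 i i = 0 := fun i => self_eq_neg.1 (hs i i)
  have e := fun i j => congrFun (congrFun hsq i) j
  simp only [Matrix.mul_apply, Fin.sum_univ_four, Matrix.zero_apply] at e
  have e00 := e 0 0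
  have e11 := e 1 1
  have e22 := e 2 2
  have e33 := e 3 3
  have e01 := e 0 1
  have e02 := e 0 2
  have e03 := e 0 3
  have e12 := e 1 2
  have e13 := e 1 3
  have e23 := e 2 3
  simp only [h0, hs 0 1, hs 0 2, hs 0 3, hs 1 2, hs 1 3, hs 2 3] at e00 e11 e22 e33 e01 e02 e03 e12 e13 e23
  have key : ∀ p ∈ ({Z.1 0 1 + Z.1 2 3, Z.1 0 2 - Z.1 1 3, Z.1 0 3 + Z.1 1 2} : Set ℂ),
      ∀ q ∈ ({Z.1 0 1 - Z.1 2 3, Z.1 0 2 + Z.1 1 3, Z.1 0 3 - Z.1 1 2} : Set ℂ), p * q = 0 := by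
    rintro p (rfl | rfl | rfl) q (rfl | rfl | rfl)
    · linear_combination (-1 / 2) * (e00 + e11 - e22 - e33)
    · linear_combination e03 - e12
    · linear_combination -e02 - e13
    · linear_combination -e12 - e03
    · linear_combination (-1 / 2) * (e00 + e22 - e11 - e33)
    · linear_combination e01 - e23
    · linear_combination e02 - e13
    · linear_combination -e01 - e23
    · linear_combination (-1 / 2) * (e00 + e33 - e11 - e22)
  by_cases hp : ∀ p ∈ ({Z.1 0 1 + Z.1 2 3, Z.1 0 2 - Z.1 1 3, Z.1 0 3 + Z.1 1 2} : Set ℂ), p = 0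
  · right
    simp only [Set.mem_insert_iff, Set.mem_singleton_iff, forall_eq_or_imp, forall_eq] at hp
    have h1 : Z.1 2 3 = -Z.1 0 1 := by linear_combination hp.1
    have h2 : Z.1 1 3 = Z.1 0 2 := by linear_combination -hp.2.1
    have h3 : Z.1 1 2 = -Z.1 0 3 := by linear_combination hp.2.2
    rw [IsAntiSelfDual]
    ext i j
    fin_cases i <;> fin_cases j <;>
      simp [hodgeStar, h0, hs 0 1, hs 0 2, hs 0 3, hs 1 2, hs 1 3, hs 2 3, h1, h2, h3]
  · left
    push Not at hp
    obtain ⟨p, hp, hp0⟩ := hp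
    have hq := fun q hq => (mul_eq_zero.1 (key p hp q hq)).resolve_left hp0
    simp only [Set.mem_insert_iff, Set.mem_singleton_iff, forall_eq_or_imp, forall_eq] at hq
    have h1 : Z.1 2 3 = Z.1 0 1 := by linear_combination -hq.1
    have h2 : Z.1 1 3 = -Z.1 0 2 := by linear_combination hq.2.1
    have h3 : Z.1 1 2 = Z.1 0 3 := by linear_combination -hq.2.2
    rw [IsSelfDual]
    ext i j
    fin_cases i <;> fin_cases j <;>
      simp [hodgeStar, h0, hs 0 1, hs 0 2, hs 0 3, hs 1 2, hs 1 3, hs 2 3, h1, h2, h3]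

theorem nnicPlus_inter_nnicMinus : nnicPlus ∩ nnicMinus ⊆ nnic := by
  rintro R ⟨h1, h2⟩ v w h
  rcases isSelfDual_or_isAntiSelfDual h with hd | hd
  · exact h1 v w h hd
  · exact h2 v w h hd

/-! ### NNIC₊ as a condition on the self-dual block -/

/-- The sum of the two smallest eigenvalues of the symmetric matrix `A` is nonnegative. -/
def TwoNonneg (A : Matrix (Fin 3) (Fin 3) ℝ) : Prop :=
  ∀ x : Fin 3 → ℝ, x ⬝ᵥ A *ᵥ x ≤ A.trace * (x ⬝ᵥ x)

theorem inner_map_sum_sd (R : CurvOp) (x : Fin 3 → ℝ) :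
    inner ℝ (R.1 (∑ i, x i • sd i)) (∑ i, x i • sd i) = 2 * (x ⬝ᵥ blockA R *ᵥ x) := by
  simp only [map_sum, map_smul, sum_inner, inner_sum, real_inner_smul_left, real_inner_smul_right,
    inner_sd_sd, dotProduct, mulVec, Finset.mul_sum]
  refine Finset.sum_congr rfl fun i _ => Finset.sum_congr rfl fun j _ => ?_
  rw [show blockA R j i = blockA R i j from congrFun (congrFun (blockA_transpose R) i) j]
  ring

theorem hermitian_of_sd {R : CurvOp} {Z : ComplexBivector} {x y : Fin 3 → ℝ}
    (hx : rePart Z = ∑ i, x i • sd i) (hy : imPart Z = ∑ i, y i • sd i) :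
    (hermitian (complexExtension R.1 Z) Z).re = 2 * (x ⬝ᵥ blockA R *ᵥ x + y ⬝ᵥ blockA R *ᵥ y) := by
  rw [hermitian_complexExtension, Complex.ofReal_re, hx, hy, inner_map_sum_sd, inner_map_sum_sd]
  ring

theorem IsSelfDual.rePart_eq {Z : ComplexBivector} (h : IsSelfDual Z) :
    rePart Z = ∑ i, (![Z.1 0 1, Z.1 0 2, Z.1 0 3] i).re • sd i := by
  have e := fun i j => congrFun (congrFun h i) j
  have hs := complexBivector_apply Z
  have h1 := e 0 1
  have h2 := e 0 2
  have h3 := e 0 3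
  simp [hodgeStar, hs 1 3] at h1 h2 h3
  apply ext_entries <;>
    simp [Fin.sum_univ_three, sd_mat, rePart, ← h1, ← h2, ← h3]

theorem IsSelfDual.imPart_eq {Z : ComplexBivector} (h : IsSelfDual Z) :
    imPart Z = ∑ i, (![Z.1 0 1, Z.1 0 2, Z.1 0 3] i).im • sd i := by
  have e := fun i j => congrFun (congrFun h i) j
  have hs := complexBivector_apply Z
  have h1 := e 0 1
  have h2 := e 0 2
  have h3 := e 0 3
  simp [hodgeStar, hs 1 3] at h1 h2 h3
  apply ext_entries <;>
    simp [Fin.sum_univ_three, sd_mat, imPart, ← h1, ← h2, ← h3]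

theorem sum_sq_eq_zero {v w : Fin 4 → ℂ} (h : SpanIsotropicPlane v w) :
    (complexWedge v w).1 0 1 ^ 2 + (complexWedge v w).1 0 2 ^ 2 + (complexWedge v w).1 0 3 ^ 2 = 0 := by
  have e := congrFun (congrFun (wedgeMatrix_mul_self h) 0) 0
  change ((complexWedge v w).1 * (complexWedge v w).1) 0 0 = 0 at e
  have hs := complexBivector_apply (complexWedge v w)
  simp only [Matrix.mul_apply, Fin.sum_univ_four, hs 0 1, hs 0 2, hs 0 3, self_eq_neg.1 (hs 0 0)] at e
  linear_combination -e

/-- With n = x × y, the orthogonality and equal lengths of x and y give tr A |n|² − ⟨An, n⟩ = |x|²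
(⟨Ax, x⟩ + ⟨Ay, y⟩), so the hypothesis at n is the claim. -/
theorem TwoNonneg.add_nonneg {A : Matrix (Fin 3) (Fin 3) ℝ} (hA : TwoNonneg A) {x y : Fin 3 → ℝ}
    (h1 : x ⬝ᵥ x = y ⬝ᵥ y) (h2 : x ⬝ᵥ y = 0) : 0 ≤ x ⬝ᵥ A *ᵥ x + y ⬝ᵥ A *ᵥ y := by
  rcases eq_or_ne x 0 with rfl | hx
  · rw [dotProduct_zero, eq_comm, dotProduct_self_eq_zero] at h1
    simp [h1]
  have hx0 : 0 < x ⬝ᵥ x := by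
    refine lt_of_le_of_ne (Finset.sum_nonneg fun i _ => mul_self_nonneg (x i)) fun h0 => ?_
    exact hx (dotProduct_self_eq_zero.1 h0.symm)
  have hn := hA ![x 1 * y 2 - x 2 * y 1, x 2 * y 0 - x 0 * y 2, x 0 * y 1 - x 1 * y 0]
  have key : A.trace * (![x 1 * y 2 - x 2 * y 1, x 2 * y 0 - x 0 * y 2, x 0 * y 1 - x 1 * y 0] ⬝ᵥ
        ![x 1 * y 2 - x 2 * y 1, x 2 * y 0 - x 0 * y 2, x 0 * y 1 - x 1 * y 0]) -
      ![x 1 * y 2 - x 2 * y 1, x 2 * y 0 - x 0 * y 2, x 0 * y 1 - x 1 * y 0] ⬝ᵥ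
        A *ᵥ ![x 1 * y 2 - x 2 * y 1, x 2 * y 0 - x 0 * y 2, x 0 * y 1 - x 1 * y 0] =
      (y ⬝ᵥ y) * (x ⬝ᵥ A *ᵥ x) - (x ⬝ᵥ y) * (x ⬝ᵥ A *ᵥ y + y ⬝ᵥ A *ᵥ x) +
        (x ⬝ᵥ x) * (y ⬝ᵥ A *ᵥ y) := by
    simp only [dotProduct, mulVec, Fin.sum_univ_three, Matrix.trace_fin_three, Matrix.cons_val]
    ring
  rw [h2, ← h1, zero_mul, sub_zero, ← mul_add] at key
  exact nonneg_of_mul_nonneg_right (by linarith) hx0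

theorem mem_nnicPlus_iff (R : CurvOp) : R ∈ nnicPlus ↔ TwoNonneg (blockA R) := by
  constructor
  · intro hR x
    rcases eq_or_ne x 0 with rfl | hx
    · simp
    have hx0 : 0 < x ⬝ᵥ x := by
      refine lt_of_le_of_ne (Finset.sum_nonneg fun i _ => mul_self_nonneg (x i)) fun h0 => ?_
      exact hx (dotProduct_self_eq_zero.1 h0.symm)
    obtain ⟨U, hU, hU'⟩ := exists_isRot ((√(x ⬝ᵥ x))⁻¹ • x) (by
      rw [smul_dotProduct, dotProduct_smul, smul_smul, ← mul_inv, Real.mul_self_sqrt hx0.le, smul_eq_mul,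
        inv_mul_cancel₀ hx0.ne'])
    obtain ⟨g, hg, h1, h2⟩ := hU.exists_specialOrthogonal
    have hb := (hasBlocks R).act_sd h1 h2
    have htr : (Uᵀ * blockA R * U).trace = (blockA R).trace := by
      rw [Matrix.trace_mul_comm, ← Matrix.mul_assoc, hU.mul_transpose, one_mul]
    -- After x is rotated to the last axis of Λ⁺, one test plane suffices: this bivector is −(sd₀ +
    -- i sd₁), and it tests the sum of the first two diagonal entries, the trace minus the last one.
    have hsd : IsSelfDual (complexWedge ![1, 0, 0, Complex.I] ![0, 1, Complex.I, 0]) := by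
      rw [IsSelfDual]
      ext i j
      fin_cases i <;> fin_cases j <;> simp [hodgeStar, complexWedge, wedgeMatrix]
    have h3 := act_mem_nnicPlus hg hR ![1, 0, 0, Complex.I] ![0, 1, Complex.I, 0] ⟨by
      rw [LinearIndependent.pair_iff]
      intro s t hst
      exact ⟨by simpa using congrFun hst 0, by simpa using congrFun hst 1⟩,
      by simp [dotProduct, Fin.sum_univ_four], by simp [dotProduct, Fin.sum_univ_four],
      by simp [dotProduct, Fin.sum_univ_four]⟩ hsd
    rw [hermitian_of_sd hsd.rePart_eq hsd.imPart_eq, hb.blockA_eq] at h3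
    have h4 := hU' (blockA R)
    rw [smul_dotProduct, mulVec_smul, dotProduct_smul, smul_smul, ← mul_inv,
        Real.mul_self_sqrt hx0.le, smul_eq_mul, inv_mul_eq_div, eq_div_iff hx0.ne'] at h4
    rw [← h4, ← htr, Matrix.trace_fin_three]
    simp [complexWedge, wedgeMatrix, mulVec, dotProduct, Fin.sum_univ_three] at h3
    gcongr
    linarith
  · intro hA v w h hsd
    rw [hermitian_of_sd hsd.rePart_eq hsd.imPart_eq]
    have h0 := sum_sq_eq_zero h
    have hre := congrArg Complex.re h0
    have him := congrArg Complex.im h0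
    simp only [sq, Complex.add_re, Complex.mul_re, Complex.zero_re] at hre
    simp only [sq, Complex.add_im, Complex.mul_im, Complex.zero_im] at him
    refine mul_nonneg two_pos.le (hA.add_nonneg ?_ ?_)
    · simp [dotProduct, Fin.sum_univ_three]
      linarith
    · simp [dotProduct, Fin.sum_univ_three]
      linarith

/-! ### NNIC₊ is a Ricci flow invariant oriented curvature cone -/

/-- Cauchy–Schwarz on each column of B: this is BBᵀ ≤ tr(BBᵀ) as quadratic forms. -/
theorem dotProduct_mulVec_transpose_le (B : Matrix (Fin 3) (Fin 3) ℝ) (x : Fin 3 → ℝ) :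
    (Bᵀ *ᵥ x) ⬝ᵥ (Bᵀ *ᵥ x) ≤ (B * Bᵀ).trace * (x ⬝ᵥ x) := by
  have h : ∀ j, (Bᵀ *ᵥ x) j * (Bᵀ *ᵥ x) j ≤ (∑ i, B i j ^ 2) * ∑ i, x i ^ 2 := by
    intro j
    have := Finset.sum_mul_sq_le_sq_mul_sq Finset.univ (fun i => B i j) x
    rwa [sq] at this
  have h' := Finset.sum_le_sum fun j (_ : j ∈ Finset.univ) => h j
  refine h'.trans (le_of_eq ?_)
  simp only [Matrix.trace, diag_apply, Matrix.mul_apply, transpose_apply, dotProduct, Fin.sum_univ_three]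
  ring

-- M² ≤ tr(M) M for M ≥ 0: write M = NᵀN and apply the previous bound at Nx.
open scoped MatrixOrder in
theorem dotProduct_mulVec_mulVec_le {M : Matrix (Fin 3) (Fin 3) ℝ} (hM : M.PosSemidef) (x : Fin 3 → ℝ) :
    (M *ᵥ x) ⬝ᵥ (M *ᵥ x) ≤ M.trace * (x ⬝ᵥ M *ᵥ x) := by
  obtain ⟨N, rfl⟩ := CStarAlgebra.nonneg_iff_eq_star_mul_self.1 hM.nonneg
  rw [star_eq_conjTranspose, conjTranspose_eq_transpose_of_trivial]
  have h := dotProduct_mulVec_transpose_le N (N *ᵥ x)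
  rw [mulVec_mulVec, Matrix.trace_mul_comm] at h
  convert h using 2
  rw [← mulVec_mulVec, dotProduct_mulVec, vecMul_transpose]

/-- The hypothesis is that M = tr(A) − A is positive semidefinite. Under the step h, M gains h times
2 tr(A) M − 2M² plus the nonnegative forms tr(A²) − A² and tr(BBᵀ) − BBᵀ. Since M² ≤ tr(M) M = 2
tr(A) M, the gain is at least −2h tr(A) M, which M absorbs for small h. -/
theorem TwoNonneg.exists_add_smul {A : Matrix (Fin 3) (Fin 3) ℝ} (hA : TwoNonneg A) (hAt : Aᵀ = A)
    (B : Matrix (Fin 3) (Fin 3) ℝ) : ∃ h₀ : ℝ, 0 < h₀ ∧ ∀ h, 0 ≤ h → h ≤ h₀ →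
      TwoNonneg (A + h • (A * A + B * Bᵀ + (2 : ℝ) • A.adjugate)) := by
  set M : Matrix (Fin 3) (Fin 3) ℝ := A.trace • 1 - A with hM
  have hMx : ∀ x, x ⬝ᵥ M *ᵥ x = A.trace * (x ⬝ᵥ x) - x ⬝ᵥ A *ᵥ x := by
    intro x
    rw [hM, sub_mulVec, smul_mulVec, one_mulVec, dotProduct_sub, dotProduct_smul, smul_eq_mul]
  have hM0 : ∀ x, 0 ≤ x ⬝ᵥ M *ᵥ x := fun x => by
    rw [hMx]
    linarith [hA x]
  have hMpsd : M.PosSemidef := by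
    refine PosSemidef.of_dotProduct_mulVec_nonneg ?_ hM0
    rw [IsHermitian, conjTranspose_eq_transpose_of_trivial, hM, transpose_sub, transpose_smul, transpose_one, hAt]
  have hMtr : M.trace = 2 * A.trace := by
    rw [hM, trace_sub, trace_smul, trace_one]
    simp
    ring
  have htr : 0 ≤ A.trace := by
    have := hMpsd.trace_nonneg
    linarith
  -- Only 2h tr A ≤ 1 is needed; the added 1 avoids a vanishing denominator.
  refine ⟨1 / (2 * A.trace + 1), by positivity, fun h h0 h1 x => ?_⟩
  have h2 := dotProduct_mulVec_mulVec_le hMpsd x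
  have h3 := dotProduct_mulVec_transpose_le B x
  have h4 := dotProduct_mulVec_transpose_le A x
  have h5 := hM0 x
  rw [hMtr] at h2
  rw [hAt] at h4
  have key : (A + h • (A * A + B * Bᵀ + (2 : ℝ) • A.adjugate)).trace * (x ⬝ᵥ x) -
      x ⬝ᵥ (A + h • (A * A + B * Bᵀ + (2 : ℝ) • A.adjugate)) *ᵥ x =
      x ⬝ᵥ M *ᵥ x + h * (2 * A.trace * (x ⬝ᵥ M *ᵥ x) - 2 * ((M *ᵥ x) ⬝ᵥ (M *ᵥ x)) +
        ((A * A).trace * (x ⬝ᵥ x) - (A *ᵥ x) ⬝ᵥ (A *ᵥ x)) +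
        ((B * Bᵀ).trace * (x ⬝ᵥ x) - (Bᵀ *ᵥ x) ⬝ᵥ (Bᵀ *ᵥ x))) := by
    have hA' := fun i j => congrFun (congrFun hAt i) j
    simp only [transpose_apply] at hA'
    rw [hM, adjugate_fin_three]
    simp [Matrix.trace_fin_three, Matrix.mul_apply, mulVec, dotProduct, Fin.sum_univ_three, one_apply,
      hA' 1 0, hA' 2 0, hA' 2 1]
    ring
  have h6 : 2 * A.trace * h ≤ 1 := by
    rw [le_div_iff₀ (by positivity)] at h1
    linarith
  have h7 : 0 ≤ (1 - 2 * A.trace * h) * (x ⬝ᵥ M *ᵥ x) := mul_nonneg (by linarith) h5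
  have h8 : h * (-(2 * A.trace * (x ⬝ᵥ M *ᵥ x))) ≤ h * (2 * A.trace * (x ⬝ᵥ M *ᵥ x) - 2 * ((M *ᵥ x) ⬝ᵥ (M *ᵥ x)) +
        ((A * A).trace * (x ⬝ᵥ x) - (A *ᵥ x) ⬝ᵥ (A *ᵥ x)) +
        ((B * Bᵀ).trace * (x ⬝ᵥ x) - (Bᵀ *ᵥ x) ⬝ᵥ (Bᵀ *ᵥ x))) :=
    mul_le_mul_of_nonneg_left (by linarith) h0
  linarith

theorem blockA_add (R S : CurvOp) : blockA (R + S) = blockA R + blockA S :=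
  ((hasBlocks R).add (hasBlocks S)).blockA_eq

theorem blockA_smul (c : ℝ) (R : CurvOp) : blockA (c • R) = c • blockA R :=
  ((hasBlocks R).smul c).blockA_eq

theorem continuous_blockA : Continuous blockA := by
  refine continuous_matrix fun i j => continuous_const.mul ?_
  exact (continuous_subtype_val.clm_apply continuous_const).inner continuous_const

theorem TwoNonneg.add {A A' : Matrix (Fin 3) (Fin 3) ℝ} (hA : TwoNonneg A) (hA' : TwoNonneg A') :
    TwoNonneg (A + A') := by
  intro x
  rw [add_mulVec, dotProduct_add, trace_add, add_mul]
  exact _root_.add_le_add (hA x) (hA' x)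

theorem TwoNonneg.smul {A : Matrix (Fin 3) (Fin 3) ℝ} (hA : TwoNonneg A) {c : ℝ} (hc : 0 ≤ c) :
    TwoNonneg (c • A) := by
  intro x
  rw [smul_mulVec, dotProduct_smul, trace_smul, smul_mul_assoc]
  exact smul_le_smul_of_nonneg_left (hA x) hc

theorem isClosed_twoNonneg : IsClosed {A | TwoNonneg A} := by
  simp only [TwoNonneg, Set.ofPred_forall]
  refine isClosed_iInter fun x => isClosed_le ?_ ?_ <;> fun_prop

/-- The form of A is at most (1 + 3/8)|x|², while its trace exceeds 5/2. The neighbourhood is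
uniform in x, which puts Id in the interior of NNIC₊. -/
theorem twoNonneg_of_near_one {A : Matrix (Fin 3) (Fin 3) ℝ} (h : ∀ i j, |A i j - (1 : Matrix _ _ ℝ) i j| < 1 / 8) :
    TwoNonneg A := by
  intro x
  have hx : ∀ i j, (A i j - (1 : Matrix _ _ ℝ) i j) * (x i * x j) ≤ 1 / 8 * ((x i ^ 2 + x j ^ 2) / 2) := by
    intro i j
    refine (le_abs_self _).trans ?_
    rw [abs_mul]
    refine mul_le_mul (h i j).le ?_ (abs_nonneg _) (by norm_num)
    rw [abs_le]
    constructor <;> nlinarith [sq_nonneg (x i + x j), sq_nonneg (x i - x j)]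
  have h00 := (abs_lt.1 (h 0 0)).1
  have h11 := (abs_lt.1 (h 1 1)).1
  have h22 := (abs_lt.1 (h 2 2)).1
  have htr : 5 / 2 * (x ⬝ᵥ x) ≤ A.trace * (x ⬝ᵥ x) := by
    refine mul_le_mul_of_nonneg_right ?_ (Finset.sum_nonneg fun i _ => mul_self_nonneg (x i))
    rw [Matrix.trace_fin_three]
    simp at h00 h11 h22
    linarith
  refine le_trans ?_ htr
  have hsum := Finset.sum_le_sum fun i (_ : i ∈ Finset.univ) => Finset.sum_le_sum fun j (_ : j ∈ Finset.univ) => hx i j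
  simp [Fin.sum_univ_three, one_apply] at hsum
  simp only [dotProduct, mulVec, Fin.sum_univ_three]
  nlinarith [sq_nonneg (x 0), sq_nonneg (x 1), sq_nonneg (x 2)]

theorem nnicPlus_eq_preimage : nnicPlus = blockA ⁻¹' {A | TwoNonneg A} := by
  ext R
  exact mem_nnicPlus_iff R

theorem isOrientedCurvatureCone_nnicPlus : IsOrientedCurvatureCone nnicPlus where
  isClosed := by
    rw [nnicPlus_eq_preimage]
    exact isClosed_twoNonneg.preimage continuous_blockA
  convex := by
    intro R hR S hS a b ha hb _
    rw [mem_nnicPlus_iff] at hR hS ⊢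
    rw [blockA_add, blockA_smul, blockA_smul]
    exact (hR.smul ha).add (hS.smul hb)
  smul_mem := by
    intro c hc R hR
    rw [mem_nnicPlus_iff] at hR ⊢
    rw [blockA_smul]
    exact hR.smul hc.le
  act_mem := fun g hg R hR => act_mem_nnicPlus hg hR
  id_mem_interior := by
    have hcont : ∀ i j, Continuous fun R : CurvOp => |blockA R i j - (1 : Matrix _ _ ℝ) i j| := fun i j =>
      ((continuous_blockA.matrix_elem i j).sub continuous_const).abs
    have h : ∀ᶠ R in 𝓝 idOp, ∀ i j, |blockA R i j - (1 : Matrix _ _ ℝ) i j| < 1 / 8 := by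
      refine Filter.eventually_all.2 fun i => Filter.eventually_all.2 fun j => ?_
      refine (hcont i j).tendsto idOp |>.eventually (gt_mem_nhds ?_)
      rw [hasBlocks_idOp.blockA_eq]
      simp
    rw [mem_interior_iff_mem_nhds]
    filter_upwards [h] with R hR
    rw [mem_nnicPlus_iff]
    exact twoNonneg_of_near_one hR

/-- The whole segment R + hQ(R), for small h ≥ 0, lies in the cone, so Q(R) is tangent along the
steps h = 1/(n + 1). -/
theorem isRicciFlowInvariant_nnicPlus : IsRicciFlowInvariant nnicPlus := by
  intro R hR
  have hRmem : R ∈ nnicPlus := isOrientedCurvatureCone_nnicPlus.isClosed.frontier_subset hR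
  rw [mem_nnicPlus_iff] at hRmem
  obtain ⟨h₀, hpos, h⟩ := hRmem.exists_add_smul (blockA_transpose R) (blockB R)
  have hmem : ∀ t : NNReal, (t : ℝ) ≤ h₀ → R + t • Q R ∈ nnicPlus := by
    intro t ht
    rw [mem_nnicPlus_iff, NNReal.smul_def, blockA_add, blockA_smul, (hasBlocks_Q (hasBlocks R)).blockA_eq]
    exact h t t.coe_nonneg ht
  have hlim : Filter.Tendsto (fun n : ℕ => (1 / ((n : NNReal) + 1) : NNReal)) Filter.atTop (𝓝 0) :=
    tendsto_one_div_add_atTop_nhds_zero_nat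
  have hlim' : Filter.Tendsto (fun n : ℕ => ((1 / ((n : NNReal) + 1) : NNReal) : ℝ)) Filter.atTop (𝓝 0) :=
    (NNReal.continuous_coe.tendsto 0).comp hlim
  refine mem_tangentConeAt_of_seq Filter.atTop (fun n : ℕ => (n : NNReal) + 1)
    (fun n : ℕ => (1 / ((n : NNReal) + 1) : NNReal) • Q R) ?_ ?_ ?_
  · have := hlim'.smul_const (Q R)
    rwa [zero_smul] at this
  · filter_upwards [hlim'.eventually (gt_mem_nhds hpos)] with n hn
    exact hmem _ hn.le
  · refine tendsto_const_nhds.congr fun n => ?_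
    rw [smul_smul, mul_one_div_cancel (by positivity), one_smul]

/-! ### Strict inclusions, the dichotomy and maximality -/

theorem TwoNonneg.trace_nonneg {A : Matrix (Fin 3) (Fin 3) ℝ} (hA : TwoNonneg A) : 0 ≤ A.trace := by
  have h0 := hA ![1, 0, 0]
  have h1 := hA ![0, 1, 0]
  have h2 := hA ![0, 0, 1]
  simp [mulVec, dotProduct, Fin.sum_univ_three, Matrix.trace_fin_three] at h0 h1 h2 ⊢
  linarith

theorem not_twoNonneg_diagonal : ¬ TwoNonneg (diagonal ![-1, -1, 2]) := by
  intro h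
  have := h ![0, 0, 1]
  simp [dotProduct, Fin.sum_univ_three, mulVec_diagonal] at this
  norm_num at this

theorem exists_weyl_sd : ∃ R, HasBlocks R (diagonal ![-1, -1, 2]) 0 0 :=
  exists_hasBlocks 0 (diagonal_transpose _) transpose_zero (by simp [Fin.sum_univ_three]; norm_num)

theorem nnicPlus_ssubset_scalCone : nnicPlus ⊂ scalCone := by
  constructor
  · intro R hR
    rw [mem_nnicPlus_iff] at hR
    rw [scalCone, Set.mem_ofPred_eq, (hasBlocks R).scal_eq]
    exact mul_nonneg (by norm_num) hR.trace_nonneg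
  · intro h
    obtain ⟨R, hR⟩ := exists_weyl_sd
    have hmem : R ∈ nnicPlus := h (by
      rw [scalCone, Set.mem_ofPred_eq, hR.scal_eq]
      simp [Fin.sum_univ_three]
      norm_num)
    rw [mem_nnicPlus_iff, hR.blockA_eq] at hmem
    exact not_twoNonneg_diagonal hmem

theorem preimage_scalCone : act reflection ⁻¹' scalCone = scalCone := by
  ext R
  rw [Set.mem_preimage, scalCone, Set.mem_ofPred_eq, Set.mem_ofPred_eq, scal_act_reflection]

/-- The mirror image of W has zero self-dual block, so it lies in NNIC₊; its anti-self-dual block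
diag(−1, −1, 2) violates NNIC₋. -/
theorem not_nnicPlus_subset_nnicMinus : ¬ nnicPlus ⊆ nnicMinus := by
  intro h
  obtain ⟨R, hR⟩ := exists_weyl_sd
  have h1 : act reflection R ∈ nnicPlus := by
    rw [mem_nnicPlus_iff, hR.act_reflection.blockA_eq]
    intro x
    simp
  have h2 := h h1
  rw [nnicMinus_eq_preimage, Set.mem_preimage, act_reflection_act_reflection, mem_nnicPlus_iff, hR.blockA_eq] at h2
  exact not_twoNonneg_diagonal h2

theorem preimage_reflection_preimage (C : Set CurvOp) :
    act reflection ⁻¹' (act reflection ⁻¹' C) = C := by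
  ext R
  rw [Set.mem_preimage, Set.mem_preimage, act_reflection_act_reflection]

theorem not_nnicMinus_subset_nnicPlus : ¬ nnicMinus ⊆ nnicPlus := by
  intro h
  apply not_nnicPlus_subset_nnicMinus
  rw [nnicMinus_eq_preimage] at h ⊢
  have h' := Set.preimage_mono (f := act reflection) h
  rwa [preimage_reflection_preimage] at h'

theorem IsOrientedCurvatureCone.lineMem_of_not_subset {C : Set CurvOp} (hC : IsOrientedCurvatureCone C)
    (hQ : IsRicciFlowInvariant C) (hs : C ⊆ scalCone) (h : ¬ C ⊆ nnicPlus)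
    (A : Matrix (Fin 3) (Fin 3) ℝ) (hA : Aᵀ = A) (htr : A.trace = 0) : LineMem C A 0 0 := by
  obtain ⟨R, hR, hR'⟩ := Set.not_subset.1 h
  rw [mem_nnicPlus_iff, TwoNonneg] at hR'
  push Not at hR'
  obtain ⟨x, hx⟩ := hR'
  exact hC.lineMem_weyl (hC.mem_weyl hQ hs (mem_blocks hR) hx) hA htr

theorem subset_nnicPlus_or_subset_nnicMinus {C : Set CurvOp} (hC : IsOrientedCurvatureCone C)
    (hQ : IsRicciFlowInvariant C) (hs : C ⊂ scalCone) : C ⊆ nnicPlus ∨ C ⊆ nnicMinus := by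
  by_contra! h
  have hs' : act reflection ⁻¹' C ⊆ scalCone := by
    rw [← preimage_scalCone]
    exact Set.preimage_mono hs.1
  have h2 : ¬ act reflection ⁻¹' C ⊆ nnicPlus := by
    intro h2
    apply h.2
    rw [nnicMinus_eq_preimage, ← preimage_reflection_preimage C]
    exact Set.preimage_mono h2
  -- Lines of D-blocks in C are the mirror images of lines of A-blocks in the reflected cone, which
  -- is not inside NNIC₊ either.
  refine hs.2 (hC.scalCone_subset hQ (hC.lineMem_of_not_subset hQ hs.1 h.1) fun D hD htr c => ?_)
  obtain ⟨R, hR, hR'⟩ :=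
    hC.preimage_reflection.lineMem_of_not_subset hQ.preimage_reflection hs' h2 D hD htr c
  refine ⟨act reflection R, hR, ?_⟩
  simpa using hR'.act_reflection

theorem IsUnorientedCurvatureCone.isOrientedCurvatureCone {C : Set CurvOp}
    (hC : IsUnorientedCurvatureCone C) : IsOrientedCurvatureCone C where
  isClosed := hC.isClosed
  convex := hC.convex
  smul_mem := hC.smul_mem
  act_mem := fun g hg => hC.act_mem g (mem_specialOrthogonalGroup_iff.1 hg).1
  id_mem_interior := hC.id_mem_interior

theorem subset_nnic {C : Set CurvOp} (hC : IsUnorientedCurvatureCone C)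
    (hQ : IsRicciFlowInvariant C) (hs : C ⊂ scalCone) : C ⊆ nnic := by
  have hrefl : ∀ R ∈ C, act reflection R ∈ C := hC.act_mem reflection reflection_mem_orthogonalGroup
  refine Set.Subset.trans (fun R hR => ?_) nnicPlus_inter_nnicMinus
  have h1 := subset_nnicPlus_or_subset_nnicMinus hC.isOrientedCurvatureCone hQ hs
  rw [nnicMinus_eq_preimage] at h1 ⊢
  rcases h1 with h1 | h1
  · exact ⟨h1 hR, h1 (hrefl R hR)⟩
  · refine ⟨?_, h1 hR⟩
    have := h1 (hrefl R hR)
    rwa [Set.mem_preimage, act_reflection_act_reflection] at this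

theorem isOrientedCurvatureCone_nnicMinus : IsOrientedCurvatureCone nnicMinus := by
  rw [nnicMinus_eq_preimage]
  exact isOrientedCurvatureCone_nnicPlus.preimage_reflection

theorem isRicciFlowInvariant_nnicMinus : IsRicciFlowInvariant nnicMinus := by
  rw [nnicMinus_eq_preimage]
  exact isRicciFlowInvariant_nnicPlus.preimage_reflection

theorem nnicMinus_ssubset_scalCone : nnicMinus ⊂ scalCone := by
  rw [nnicMinus_eq_preimage, ← preimage_scalCone]
  refine ⟨Set.preimage_mono nnicPlus_ssubset_scalCone.1, fun h => nnicPlus_ssubset_scalCone.2 ?_⟩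
  have h' := Set.preimage_mono (f := act reflection) h
  rwa [preimage_reflection_preimage, preimage_reflection_preimage] at h'

end HalfPIC

theorem mainTheorem1 :
    (∀ C : Set HalfPIC.CurvOp, HalfPIC.IsOrientedCurvatureCone C →
      HalfPIC.IsRicciFlowInvariant C → C ⊂ HalfPIC.scalCone →
        C ⊆ HalfPIC.nnicPlus ∨ C ⊆ HalfPIC.nnicMinus) ∧
    (∀ C : Set HalfPIC.CurvOp, HalfPIC.IsUnorientedCurvatureCone C →
      HalfPIC.IsRicciFlowInvariant C → C ⊂ HalfPIC.scalCone → C ⊆ HalfPIC.nnic) ∧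
    Maximal (fun C : Set HalfPIC.CurvOp => HalfPIC.IsOrientedCurvatureCone C ∧
      HalfPIC.IsRicciFlowInvariant C ∧ C ⊂ HalfPIC.scalCone) HalfPIC.nnicPlus ∧
    Maximal (fun C : Set HalfPIC.CurvOp => HalfPIC.IsOrientedCurvatureCone C ∧
      HalfPIC.IsRicciFlowInvariant C ∧ C ⊂ HalfPIC.scalCone) HalfPIC.nnicMinus := by
  refine ⟨fun C hC hQ hs => HalfPIC.subset_nnicPlus_or_subset_nnicMinus hC hQ hs,
    fun C hC hQ hs => HalfPIC.subset_nnic hC hQ hs,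
    ⟨⟨HalfPIC.isOrientedCurvatureCone_nnicPlus, HalfPIC.isRicciFlowInvariant_nnicPlus,
      HalfPIC.nnicPlus_ssubset_scalCone⟩, ?_⟩,
    ⟨⟨HalfPIC.isOrientedCurvatureCone_nnicMinus, HalfPIC.isRicciFlowInvariant_nnicMinus,
      HalfPIC.nnicMinus_ssubset_scalCone⟩, ?_⟩⟩
  · rintro C ⟨hC, hQ, hs⟩ hle
    exact (HalfPIC.subset_nnicPlus_or_subset_nnicMinus hC hQ hs).resolve_right fun h =>
      HalfPIC.not_nnicPlus_subset_nnicMinus (Set.Subset.trans hle h)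
  · rintro C ⟨hC, hQ, hs⟩ hle
    exact (HalfPIC.subset_nnicPlus_or_subset_nnicMinus hC hQ hs).resolve_left fun h =>
      HalfPIC.not_nnicMinus_subset_nnicPlus (Set.Subset.trans hle h)
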